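/- Let $(E,\mathcal E)$ be a (standard) Borel space, $\alpha$ a finite measure on $E$ and $p\in(0,1)$. Let $\mathbf N_{<\infty}$ be the space of finite counting measures on $E$ (measures with $\eta(B)\in\mathbb N_0$ for all $B\in\mathcal E$), with the $\sigma$-algebra generated by the maps $\eta\mapsto\eta(B)$, $B\in\mathcal E$. Let $\rho$ be the Pascal distribution with parameters $p$ and $\alpha$, i.e. a probability measure on $\mathbf N_{<\infty}$ under which $\eta(B_1),\dots,\eta(B_m)$ are independent for all pairwise disjoint $B_1,\dots,B_m\in\mathcal E$, and $$\rho\bigl(\eta(B)=k\bigr)=(1-p)^{\alpha(B)}\,\alpha(B)(\alpha(B)+1)\cdots(\alpha(B)+k-1)\,\frac{p^k}{k!},\qquad k\in\mathbb N_0,\ B\in\mathcal E .$$ For $n\in\mathbb N_0$ let $\mathcal F_n$ be the set of bounded, measurable, permutation invariant functions $f_n:E^n\to\mathbb R$ (with $\mathcal F_0=\mathbb R$). For every bounded measurable $f_n:E^n\to\mathbb R$ the map $\eta\mapsto\eta^{\otimes n}(f_n)=\int f_n\,\mathrm d\eta^{\otimes n}$ (equal to the constant $f_0$ if $n=0$)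 belongs to $L^2(\rho)$. Let $\mathcal P_n\subset L^2(\rho)$ be the linear span of the maps $\eta\mapsto\eta^{\otimes k}(f_k)$ with $k\le n$ and $f_k:E^k\to\mathbb R$ bounded measurable, let $\mathcal P_{-1}=\{0\}$, and let $I_n(f_n)=I_n(f_n,\cdot)$ be the orthogonal projection in $L^2(\rho)$ of $\eta\mapsto\eta^{\otimes n}(f_n)$ onto $\overline{\mathcal P_{n-1}}^{\perp}$. Let $\Sigma_n$ be the collection of set partitions of $\{1,\dots,n\}$. For $\sigma\in\Sigma_n$ with $|\sigma|$ blocks and $g:E^n\to\mathbb R$, let $g_\sigma:E^{|\sigma|}\to\mathbb R$ be obtained from $g$ by identifying the arguments that belong to the same block of $\sigma$, and define the measure $\lambda_n$ on $E^n$ by $$\lambda_n(B)=\sum_{\sigma\in\Sigma_n}\Bigl(\prod_{A\in\sigma}(|A|-1)!\Bigr)\int(\mathbf 1_B)_\sigma\,\mathrm d\alpha^{\otimes|\sigma|},\qquad B\in\mathcal E^{n},$$ where for $n=0$ one has $\int f_0g_0\,\mathrm d\lambda_0=f_0g_0$. Then for all $n,m\in\mathbb N_0$, $f_n\in\mathcal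 F_n$ and $g_m\in\mathcal F_m$, $$\int I_n(f_n,\cdot)\,I_m(g_m,\cdot)\,\mathrm d\rho=\mathbf 1_{\{n=m\}}\,\frac{p^n\,n!}{(1-p)^{2n}}\int f_n\,g_m\,\mathrm d\lambda_n .$$ -/

import Mathlib

open MeasureTheory ProbabilityTheory
open scoped ENNReal Nat

namespace Pascal

noncomputable section

/-- Finite counting measures on `E`: measures that assign a value in `ℕ` to every measurable set
(in particular to `E` itself, so that they are finite). As a subtype of `Measure E` the space
carries the sigma-algebra generated by the counting variables `η ↦ η B`, `B` measurable. -/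
abbrev CountingMeasure (E : Type*) [MeasurableSpace E] : Type _ :=
  {η : Measure E // ∀ B : Set E, MeasurableSet B → ∃ k : ℕ, η B = (k : ℝ≥0∞)}

/-- `ρ` is the distribution of a Pascal point process with parameters `p` and `α`. -/
structure IsPascal {E : Type*} [MeasurableSpace E] (p : ℝ) (α : Measure E)
    (ρ : Measure (CountingMeasure E)) : Prop where
  isProbabilityMeasure : IsProbabilityMeasure ρ
  /-- Counts in pairwise disjoint regions are independent. -/
  indep : ∀ (m : ℕ) (B : Fin m → Set E), (∀ i, MeasurableSet (B i)) →
    Pairwise (fun i j => Disjoint (B i) (B j)) →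
    iIndepFun (fun (i : Fin m) (η : CountingMeasure E) => η.1 (B i)) ρ
  /-- The count in `B` has the negative binomial law with parameters `α B` and `p`. -/
  law : ∀ B : Set E, MeasurableSet B → ∀ k : ℕ,
    ρ {η : CountingMeasure E | η.1 B = (k : ℝ≥0∞)} =
      ENNReal.ofReal ((1 - p) ^ (α.real B) *
        (∏ i ∈ Finset.range k, (α.real B + (i : ℝ))) * (p ^ k / (k ! : ℝ)))

/-- Bounded measurable functions on `E^n`. -/
def IsBddMeas {E : Type*} [MeasurableSpace E] {n : ℕ} (f : (Fin n → E) → ℝ) : Prop :=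
  Measurable f ∧ ∃ C : ℝ, ∀ x, |f x| ≤ C

/-- Bounded, measurable, permutation invariant functions on `E^n`. As `E^0` is a point, these are
the real numbers if `n = 0`. -/
def IsSymmBddMeas {E : Type*} [MeasurableSpace E] {n : ℕ} (f : (Fin n → E) → ℝ) : Prop :=
  IsBddMeas f ∧ ∀ (π : Equiv.Perm (Fin n)) (x : Fin n → E), f (fun i => x (π i)) = f x

/-- The monomial `η ↦ η^{⊗ n}(f) = ∫ f dη^{⊗ n}`. For `n = 0` it is the constant value of `f`. -/
def monomial {E : Type*} [MeasurableSpace E] (n : ℕ) (f : (Fin n → E) → ℝ)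
    (η : CountingMeasure E) : ℝ :=
  ∫ x, f x ∂(Measure.pi (fun _ : Fin n => η.1))

open Classical in
/-- The monomial as an element of `L²(ρ)` (zero if it is not square integrable; this does not
occur if all moments of the number of particles are finite). -/
def monomialL2 {E : Type*} [MeasurableSpace E] (ρ : Measure (CountingMeasure E))
    (n : ℕ) (f : (Fin n → E) → ℝ) : Lp ℝ 2 ρ :=
  if h : MemLp (monomial n f) 2 ρ then h.toLp (monomial n f) else 0

/-- Generalized polynomials of degree at most `n`, as a subspace of `L²(ρ)`: linear combinations
of monomials of degree `k ≤ n` with bounded measurable coefficients. -/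
def polynomials {E : Type*} [MeasurableSpace E] (ρ : Measure (CountingMeasure E)) (n : ℕ) :
    Submodule ℝ (Lp ℝ 2 ρ) :=
  Submodule.span ℝ {F | ∃ k : ℕ, k ≤ n ∧ ∃ f : (Fin k → E) → ℝ, IsBddMeas f ∧
    F = monomialL2 ρ k f}

/-- Generalized polynomials of degree at most `n - 1`; the zero subspace if `n = 0`. -/
def polynomialsBelow {E : Type*} [MeasurableSpace E] (ρ : Measure (CountingMeasure E)) :
    ℕ → Submodule ℝ (Lp ℝ 2 ρ)
  | 0 => ⊥
  | n + 1 => polynomials ρ n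

/-- The generalized orthogonal polynomial `I_n(f)`: the orthogonal projection in `L²(ρ)` of the
monomial `η ↦ η^{⊗ n}(f)` onto the orthogonal complement of the closure of the space of
generalized polynomials of degree at most `n - 1`. -/
def orthPoly {E : Type*} [MeasurableSpace E] (ρ : Measure (CountingMeasure E))
    (n : ℕ) (f : (Fin n → E) → ℝ) : Lp ℝ 2 ρ :=
  ((polynomialsBelow ρ n).topologicalClosureᗮ).starProjection (monomialL2 ρ n f)

/-- For a set partition `σ` of the index set, the point of `E^n` obtained from a point `y` of
`E^{|σ|}` (coordinates labelled by the blocks of `σ`) by giving to all coordinates in a block `A`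
the value `y A`. Thus `g ∘ diagonalMap σ` is `g` with the arguments in each block identified. -/
def diagonalMap {E : Type*} {n : ℕ} (σ : Finpartition (Finset.univ : Finset (Fin n)))
    (y : σ.parts → E) : Fin n → E :=
  fun i => y ⟨σ.part i, σ.part_mem.2 (Finset.mem_univ i)⟩

/-- The measure `λ_n` on `E^n`: the sum over set partitions `σ` of `{1, …, n}` of
`∏_{A ∈ σ} (|A| - 1)!` times the image of `α^{⊗ |σ|}` on the diagonal given by `σ`. -/
def lambdaMeasure {E : Type*} [MeasurableSpace E] (α : Measure E) (n : ℕ) :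
    Measure (Fin n → E) :=
  ∑ σ : Finpartition (Finset.univ : Finset (Fin n)),
    ((∏ A ∈ σ.parts, (A.card - 1)! : ℕ) : ℝ≥0∞) •
      (Measure.pi (fun _ : σ.parts => α)).map (diagonalMap σ)

theorem measurable_diagonalMap {E : Type*} [MeasurableSpace E] {n : ℕ}
    (σ : Finpartition (Finset.univ : Finset (Fin n))) :
    Measurable (diagonalMap (E := E) σ) :=
  measurable_pi_lambda _ fun _ => measurable_pi_apply _

theorem lambdaMeasure_apply {E : Type*} [MeasurableSpace E] (α : Measure E) (n : ℕ)
    {B : Set (Fin n → E)} (hB : MeasurableSet B) :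
    lambdaMeasure α n B = ∑ σ : Finpartition (Finset.univ : Finset (Fin n)),
      ((∏ A ∈ σ.parts, (A.card - 1)! : ℕ) : ℝ≥0∞) *
        ∫⁻ y, B.indicator 1 (diagonalMap σ y) ∂(Measure.pi (fun _ : σ.parts => α)) := by
  simp only [lambdaMeasure, Measure.coe_finsetSum, Finset.sum_apply, Measure.smul_apply,
    smul_eq_mul]
  refine Finset.sum_congr rfl fun σ _ => ?_
  rw [← lintegral_map (measurable_one.indicator hB) (measurable_diagonalMap σ),
    lintegral_indicator_one hB]

end

end Pascal

/-! For a tensor power u^{⊗n} with u of finite range, the orthogonal polynomial is explicit.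
Consider the generating function exp(∫ log(1 + tu/p) dη - ∫ log(1 + tu) d(α + η)), with coefficients
`chaosPoly`. Over the level sets of u it splits into a product of generating functions of Meixner
polynomials in the counts. Under the negative binomial law these polynomials are orthogonal to lower
powers by a summation by parts (`tsum_nbWeight_mul_meixner`). By independence, the n-th coefficient
is then orthogonal to (∫ v dη)^k for k < n. Its leading term is (1/p - 1)^n / n! (∫ u dη)^n, so n!
(p / (1 - p))^n times it is I_n(u^{⊗n}).

Pairing that coefficient with (∫ v dη)^n leaves only diagonal terms, which sum to n! / (1 - p)^n
times the coefficient of t^n in exp(-∫ log(1 - tuv) dα). By the exponential formula for set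
partitions (`sum_finpartition_eq_expCoeff`) this coefficient is (1 / n!) ∫ (uv)^{⊗n} dλ_n. The
constants multiply to p^n n! / (1 - p)^{2n}.

General symmetric functions are reached by polarization: Ryser's formula writes a symmetrized
rectangle as a combination of tensor powers, and a monotone class argument does the rest
(`IsBddClosed.of_pow`). For different degrees, orthogonality is immediate from the definition as a
projection. All series are formal: an exponential is encoded by G(0) = 1 and its logarithmic
derivative. -/

namespace Pascal

noncomputable section

/-! ### Rising factorials and formal generating series. -/

section

/-- The rising factorial `a (a + 1) ⋯ (a + k - 1)`. -/
def risingFactorial (a : ℝ) (k : ℕ) : ℝ := ∏ i ∈ Finset.range k, (a + (i : ℝ))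

@[simp]
theorem risingFactorial_zero (a : ℝ) : risingFactorial a 0 = 1 := by
  simp [risingFactorial]

theorem risingFactorial_succ (a : ℝ) (k : ℕ) :
    risingFactorial a (k + 1) = risingFactorial a k * (a + k) := by
  simp [risingFactorial, Finset.prod_range_succ]

theorem risingFactorial_succ' (a : ℝ) (k : ℕ) :
    risingFactorial a (k + 1) = a * risingFactorial (a + 1) k := by
  rw [risingFactorial, risingFactorial, Finset.prod_range_succ', mul_comm]
  simp [add_assoc, add_comm (1 : ℝ)]

theorem risingFactorial_add (a : ℝ) (j k : ℕ) :
    risingFactorial a (j + k) = risingFactorial a j * risingFactorial (a + j) k := by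
  simp [risingFactorial, Finset.prod_range_add, add_assoc]

theorem risingFactorial_nonneg {a : ℝ} (ha : 0 ≤ a) (k : ℕ) : 0 ≤ risingFactorial a k :=
  Finset.prod_nonneg fun _ _ => by positivity

/-- Up to sign this is a falling factorial of x. Its vanishing is what later makes index shifts free
of boundary terms. -/
theorem risingFactorial_neg_natCast_of_lt {x i : ℕ} (h : x < i) :
    risingFactorial (-(x : ℝ)) i = 0 :=
  Finset.prod_eq_zero (Finset.mem_range.2 h) (by simp)

theorem risingFactorial_neg_natCast_add (x i : ℕ) :
    risingFactorial (-((x + i : ℕ) : ℝ)) i * (x ! : ℝ) = (-1) ^ i * ((x + i)! : ℝ) := by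
  induction i generalizing x with
  | zero => simp
  | succ i ih =>
    have h := ih x
    rw [risingFactorial_succ']
    have e : -((x + (i + 1) : ℕ) : ℝ) + 1 = -((x + i : ℕ) : ℝ) := by push_cast; ring
    rw [e, mul_assoc, h, ← add_assoc, Nat.factorial_succ]
    push_cast
    ring

theorem exists_polynomial_risingFactorial (a : ℝ) (n : ℕ) :
    ∃ P : Polynomial ℝ, ∀ y : ℝ, risingFactorial (a + y) n = P.eval y :=
  ⟨∏ i ∈ Finset.range n, (Polynomial.X + Polynomial.C (a + i)), fun y => by
    simp only [risingFactorial, Polynomial.eval_prod, Polynomial.eval_add, Polynomial.eval_X,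
      Polynomial.eval_C]
    exact Finset.prod_congr rfl fun i _ => by ring⟩

/-- Coefficientwise form of G' = a G / (1 - t) for G = (1 - t)^(-a). -/
theorem risingFactorial_succ_div (a : ℝ) (n : ℕ) :
    risingFactorial a (n + 1) / (n ! : ℝ) =
      ∑ j ∈ Finset.range (n + 1), a * (risingFactorial a j / (j ! : ℝ)) := by
  induction n with
  | zero => simp [risingFactorial]
  | succ n ih =>
    rw [Finset.sum_range_succ, ← ih, risingFactorial_succ a (n + 1), Nat.factorial_succ]
    have : (n ! : ℝ) ≠ 0 := by positivity
    push_cast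
    field_simp
    ring

/-- The power series of `(1 - s t) ^ (-a)`. -/
def riseSeries (s a : ℝ) : PowerSeries ℝ :=
  PowerSeries.mk fun k => risingFactorial a k / (k ! : ℝ) * s ^ k

@[simp]
theorem coeff_riseSeries (s a : ℝ) (k : ℕ) :
    PowerSeries.coeff k (riseSeries s a) = risingFactorial a k / (k ! : ℝ) * s ^ k :=
  PowerSeries.coeff_mk _ _

theorem constantCoeff_riseSeries (s a : ℝ) : PowerSeries.constantCoeff (riseSeries s a) = 1 := by
  rw [← PowerSeries.coeff_zero_eq_constantCoeff_apply]; simp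

theorem derivative_riseSeries (s a : ℝ) :
    PowerSeries.derivative ℝ (riseSeries s a) =
      (PowerSeries.mk fun k => a * s ^ (k + 1)) * riseSeries s a := by
  ext n
  rw [PowerSeries.coeff_derivative, mul_comm (PowerSeries.mk _), PowerSeries.coeff_mul,
    Finset.Nat.sum_antidiagonal_eq_sum_range_succ_mk, coeff_riseSeries, Nat.factorial_succ]
  have h := risingFactorial_succ_div a n
  have h0 : (n ! : ℝ) ≠ 0 := by positivity
  have : risingFactorial a (n + 1) / (((n + 1) * n ! : ℕ) : ℝ) * s ^ (n + 1) * ((n : ℝ) + 1) =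
      risingFactorial a (n + 1) / (n ! : ℝ) * s ^ (n + 1) := by
    push_cast; field_simp
  rw [this, h, Finset.sum_mul]
  refine Finset.sum_congr rfl fun j hj => ?_
  have hj : j ≤ n := Nat.lt_succ_iff.1 (Finset.mem_range.1 hj)
  rw [coeff_riseSeries, PowerSeries.coeff_mk]
  have : s ^ (n + 1) = s ^ j * s ^ (n - j + 1) := by rw [← pow_add]; congr 1; omega
  rw [this]; ring

theorem derivative_prod_of_logDeriv {ι : Type*} (s : Finset ι) (G Ψ : ι → PowerSeries ℝ)
    (h : ∀ c ∈ s, PowerSeries.derivative ℝ (G c) = Ψ c * G c) :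
    PowerSeries.derivative ℝ (∏ c ∈ s, G c) = (∑ c ∈ s, Ψ c) * ∏ c ∈ s, G c := by
  classical
  induction s using Finset.induction_on with
  | empty => simp
  | insert a s ha ih =>
    rw [Finset.prod_insert ha, Finset.sum_insert ha, Derivation.leibniz,
      ih fun c hc => h c (Finset.mem_insert_of_mem hc), h a (Finset.mem_insert_self _ _)]
    simp only [smul_eq_mul]
    ring

/-- The coefficients of the power series `G` with `G(0) = 1` and `G' = G ∑ ψ k t ^ k`. -/
def expCoeff (ψ : ℕ → ℝ) : ℕ → ℝ
  | 0 => 1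
  | n + 1 => (∑ i : Fin (n + 1), ψ (n - i) * expCoeff ψ i) / ((n : ℝ) + 1)

@[simp]
theorem expCoeff_zero (ψ : ℕ → ℝ) : expCoeff ψ 0 = 1 := by simp [expCoeff]

theorem expCoeff_succ (ψ : ℕ → ℝ) (n : ℕ) :
    expCoeff ψ (n + 1) =
      (∑ i ∈ Finset.range (n + 1), ψ (n - i) * expCoeff ψ i) / ((n : ℝ) + 1) := by
  rw [expCoeff, Finset.sum_range]

/-- A formal series is determined by its constant term and logarithmic derivative; comparing
coefficients gives the recursion. This is how products of binomial series and exponentials of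
integrals are identified. -/
theorem coeff_eq_expCoeff {G : PowerSeries ℝ} {ψ : ℕ → ℝ}
    (h0 : PowerSeries.constantCoeff G = 1)
    (h : PowerSeries.derivative ℝ G = PowerSeries.mk ψ * G) (n : ℕ) :
    PowerSeries.coeff n G = expCoeff ψ n := by
  induction n using Nat.strong_induction_on with
  | _ n ih =>
    cases n with
    | zero => simpa using h0
    | succ n =>
      have h1 := congrArg (PowerSeries.coeff n) h
      rw [PowerSeries.coeff_derivative, mul_comm (PowerSeries.mk _), PowerSeries.coeff_mul,
        Finset.Nat.sum_antidiagonal_eq_sum_range_succ_mk] at h1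
      rw [expCoeff_succ, eq_div_iff (by positivity), h1]
      refine Finset.sum_congr rfl fun j hj => ?_
      rw [PowerSeries.coeff_mk, ih j (Finset.mem_range.1 hj), mul_comm]

theorem coeff_prod_riseSeries {ι : Type*} (t : Finset ι) (s a : ι → ℝ) (n : ℕ) :
    PowerSeries.coeff n (∏ c ∈ t, riseSeries (s c) (a c)) =
      expCoeff (fun k => ∑ c ∈ t, a c * s c ^ (k + 1)) n := by
  refine coeff_eq_expCoeff ?_ ?_ n
  · rw [map_prod]
    exact Finset.prod_eq_one fun c _ => constantCoeff_riseSeries _ _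
  · rw [derivative_prod_of_logDeriv t _ _ fun c _ => derivative_riseSeries (s c) (a c)]
    congr 1
    ext k
    simp

/-! ### Meixner polynomials and the negative binomial law. -/

/-- The Meixner polynomial of degree `n` with parameters `p` and `a`, normalized as the
coefficient of `t ^ n` in `(1 + t / p) ^ x * (1 + t) ^ (-(a + x))`. -/
def meixner (p a : ℝ) (n : ℕ) (x : ℝ) : ℝ :=
  PowerSeries.coeff n (riseSeries (-p⁻¹) (-x) * riseSeries (-1) (a + x))

theorem meixner_eq (p a : ℝ) (n : ℕ) (x : ℝ) :
    meixner p a n x = ∑ ij ∈ Finset.HasAntidiagonal.antidiagonal n,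
      (risingFactorial (-x) ij.1 / (ij.1 ! : ℝ) * (-p⁻¹) ^ ij.1) *
        (risingFactorial (a + x) ij.2 / (ij.2 ! : ℝ) * (-1) ^ ij.2) := by
  simp [meixner, PowerSeries.coeff_mul]

/-- Substituting u t for t; u will be the value of the test function on a cell. -/
theorem coeff_riseSeries_mul_riseSeries (p a x u : ℝ) (n : ℕ) :
    PowerSeries.coeff n (riseSeries (-(u * p⁻¹)) (-x) * riseSeries (-u) (a + x)) =
      u ^ n * meixner p a n x := by
  rw [meixner_eq, PowerSeries.coeff_mul, Finset.mul_sum]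
  refine Finset.sum_congr rfl fun ij h => ?_
  rw [← Finset.HasAntidiagonal.mem_antidiagonal.1 h, coeff_riseSeries, coeff_riseSeries, pow_add,
    neg_mul_eq_mul_neg, mul_pow, neg_eq_neg_one_mul u, mul_pow (-1)]
  ring

theorem exists_polynomial_meixner (p a : ℝ) (n : ℕ) :
    ∃ P : Polynomial ℝ, ∀ y : ℝ, meixner p a n y = P.eval y := by
  choose A hA using exists_polynomial_risingFactorial a
  choose B hB using exists_polynomial_risingFactorial 0
  refine ⟨∑ ij ∈ Finset.HasAntidiagonal.antidiagonal n,
    ((B ij.1).comp (-Polynomial.X) * Polynomial.C ((-p⁻¹) ^ ij.1 / (ij.1 ! : ℝ))) *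
      (A ij.2 * Polynomial.C ((-1) ^ ij.2 / (ij.2 ! : ℝ))), fun y => ?_⟩
  rw [meixner_eq, Polynomial.eval_finsetSum]
  refine Finset.sum_congr rfl fun ij _ => ?_
  simp only [Polynomial.eval_mul, Polynomial.eval_comp, Polynomial.eval_neg, Polynomial.eval_X,
    Polynomial.eval_C, ← hA, ← hB, zero_add]
  ring

/-- The weights of the negative binomial distribution. -/
def nbWeight (p a : ℝ) (k : ℕ) : ℝ :=
  (1 - p) ^ a * risingFactorial a k * (p ^ k / (k ! : ℝ))

theorem nbWeight_nonneg {p a : ℝ} (hp0 : 0 < p) (hp1 : p < 1) (ha : 0 ≤ a) (k : ℕ) :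
    0 ≤ nbWeight p a k :=
  mul_nonneg (mul_nonneg (Real.rpow_nonneg (by linarith) _) (risingFactorial_nonneg ha k))
    (by positivity)

/-- Multiplying by the falling factorial of order i and p^(-i) moves the weight from x + i back to
x. The resulting rising factorial depends only on i + j, so all summands of the Meixner polynomial
acquire the same factor. -/
theorem nbWeight_add_mul {p : ℝ} (hp0 : 0 < p) (a : ℝ) (x i j : ℕ) :
    nbWeight p a (x + i) * ((risingFactorial (-((x + i : ℕ) : ℝ)) i / (i ! : ℝ) * (-p⁻¹) ^ i) *
      (risingFactorial (a + ((x + i : ℕ) : ℝ)) j / (j ! : ℝ) * (-1) ^ j)) =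
    nbWeight p a x * risingFactorial (a + x) (i + j) * ((-1) ^ j / ((i ! : ℝ) * (j ! : ℝ))) := by
  have h := risingFactorial_neg_natCast_add x i
  have hx : (x ! : ℝ) ≠ 0 := by positivity
  have hi : (i ! : ℝ) ≠ 0 := by positivity
  have hj : (j ! : ℝ) ≠ 0 := by positivity
  have hxi : ((x + i)! : ℝ) ≠ 0 := by positivity
  have hp : p ≠ 0 := hp0.ne'
  have h' : risingFactorial (-((x + i : ℕ) : ℝ)) i = (-1) ^ i * ((x + i)! : ℝ) / (x ! : ℝ) := by
    rw [eq_div_iff hx, h]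
  have e : ((-1 : ℝ) ^ i) * (-p⁻¹) ^ i = (p ^ i)⁻¹ := by
    rw [← mul_pow]; simp
  have e2 : a + ((x + i : ℕ) : ℝ) = a + x + i := by push_cast; ring
  rw [h', nbWeight, nbWeight, risingFactorial_add, risingFactorial_add, e2, pow_add]
  calc _ = (1 - p) ^ a * (risingFactorial a x * risingFactorial (a + x) i) *
        (p ^ x * p ^ i / ((x + i)! : ℝ)) * (((x + i)! : ℝ) / (x ! : ℝ) / (i ! : ℝ) *
        ((-1) ^ i * (-p⁻¹) ^ i) * (risingFactorial (a + x + i) j / (j ! : ℝ) * (-1) ^ j)) := by ring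
    _ = _ := by rw [e]; field_simp

theorem summable_nbWeight_mul_pow {p : ℝ} (hp0 : 0 < p) (hp1 : p < 1) {a : ℝ} (ha : 0 ≤ a)
    (m : ℕ) : Summable fun k : ℕ => nbWeight p a k * (k : ℝ) ^ m := by
  -- For a = 0 the weights vanish beyond k = 0, so the ratio test does not apply.
  rcases ha.eq_or_lt with rfl | ha
  · refine summable_of_ne_finset_zero (s := {0}) fun k hk => ?_
    obtain ⟨k, rfl⟩ := Nat.exists_eq_succ_of_ne_zero (by simpa using hk)
    simp [nbWeight, risingFactorial_succ']
  have hpos : ∀ k, 0 < nbWeight p a k := fun k =>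
    mul_pos (mul_pos (Real.rpow_pos_of_pos (by linarith) _)
      (Finset.prod_pos fun _ _ => by positivity)) (by positivity)
  refine summable_of_ratio_test_tendsto_lt_one hp1 ?_ ?_
  · filter_upwards [Filter.eventually_gt_atTop 0] with k hk
    exact (mul_pos (hpos k) (by positivity)).ne'
  · have h1 : Filter.Tendsto (fun k : ℕ => ((k : ℝ) + 1) / k) Filter.atTop (nhds 1) := by
      have := tendsto_natCast_div_add_atTop (1 : ℝ)
      have := this.inv₀ one_ne_zero
      simpa using this
    have h2 : Filter.Tendsto (fun k : ℕ => p * ((a + k) / ((k : ℝ) + 1)))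
        Filter.atTop (nhds (p * 1)) := by
      refine Filter.Tendsto.const_mul _ ?_
      have e : (fun k : ℕ => (a + k) / ((k : ℝ) + 1)) =
          fun k : ℕ => 1 + (a - 1) / ((k : ℝ) + 1) := by
        ext k
        have : (k : ℝ) + 1 ≠ 0 := by positivity
        field_simp
        ring
      rw [e]
      have := (tendsto_one_div_add_atTop_nhds_zero_nat (𝕜 := ℝ)).const_mul (a - 1)
      simpa [div_eq_mul_inv] using this.const_add 1
    have h3 := h2.mul (h1.pow m)
    rw [one_pow, mul_one, mul_one] at h3
    refine h3.congr' ?_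
    filter_upwards [Filter.eventually_gt_atTop 0] with k hk
    have hk' : (k : ℝ) ≠ 0 := by positivity
    rw [Real.norm_of_nonneg (mul_nonneg (hpos _).le (by positivity)),
      Real.norm_of_nonneg (mul_nonneg (hpos _).le (by positivity)), nbWeight, nbWeight,
      risingFactorial_succ, pow_succ, Nat.factorial_succ]
    have h4 : (1 - p) ^ a ≠ 0 := (Real.rpow_pos_of_pos (by linarith) _).ne'
    have h5 : risingFactorial a k ≠ 0 := (Finset.prod_pos fun _ _ => by positivity).ne'
    have h6 : (k ! : ℝ) ≠ 0 := by positivity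
    rw [div_pow]
    push_cast
    field_simp

theorem summable_nbWeight_mul_eval {p : ℝ} (hp0 : 0 < p) (hp1 : p < 1) {a : ℝ} (ha : 0 ≤ a)
    (P : Polynomial ℝ) : Summable fun k : ℕ => nbWeight p a k * P.eval (k : ℝ) := by
  simp only [Polynomial.eval_eq_sum_range, Finset.mul_sum]
  refine summable_sum fun i _ => ?_
  refine ((summable_nbWeight_mul_pow hp0 hp1 ha i).mul_left (P.coeff i)).congr fun k => ?_
  ring

/-- The recursion (k + 1) w(k + 1) = p (a + k) w(k) gives E[X (a + X)_n] = p E[(a + X)_{n+1}].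
Splitting the last factor a + k + n then yields (1 - p) E[(a + X)_{n+1}] = (a + n) E[(a + X)_n]. -/
theorem tsum_nbWeight_mul_risingFactorial {p : ℝ} (hp0 : 0 < p) (hp1 : p < 1) {a : ℝ}
    (ha : 0 ≤ a) (hsum : ∑' k, nbWeight p a k = 1) (n : ℕ) :
    ∑' k : ℕ, nbWeight p a k * risingFactorial (a + k) n = risingFactorial a n / (1 - p) ^ n := by
  have hs : ∀ n, Summable fun k : ℕ => nbWeight p a k * risingFactorial (a + k) n := fun n => by
    obtain ⟨P, hP⟩ := exists_polynomial_risingFactorial a n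
    simpa only [hP] using summable_nbWeight_mul_eval hp0 hp1 ha P
  have hs' : ∀ n, Summable fun k : ℕ => nbWeight p a k * (k * risingFactorial (a + k) n) :=
    fun n => by
      obtain ⟨P, hP⟩ := exists_polynomial_risingFactorial a n
      refine (summable_nbWeight_mul_eval hp0 hp1 ha (Polynomial.X * P)).congr fun k => ?_
      rw [hP, Polynomial.eval_mul, Polynomial.eval_X]
  induction n with
  | zero => simpa using hsum
  | succ n ih =>
    have h1 : ∑' k : ℕ, nbWeight p a k * (k * risingFactorial (a + k) n) =
        p * ∑' k : ℕ, nbWeight p a k * risingFactorial (a + k) (n + 1) := by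
      rw [(hs' n).tsum_eq_zero_add, ← tsum_mul_left]
      simp only [CharP.cast_eq_zero, zero_mul, mul_zero, zero_add]
      refine tsum_congr fun k => ?_
      have h2 : nbWeight p a (k + 1) * ((k : ℝ) + 1) = p * (a + k) * nbWeight p a k := by
        have : (k ! : ℝ) ≠ 0 := by positivity
        rw [nbWeight, nbWeight, risingFactorial_succ, pow_succ, Nat.factorial_succ]
        push_cast
        field_simp
      rw [risingFactorial_succ']
      push_cast
      rw [← mul_assoc, h2, add_assoc]
      ring
    have h2 : ∑' k : ℕ, nbWeight p a k * risingFactorial (a + k) (n + 1) =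
        (a + n) * (∑' k : ℕ, nbWeight p a k * risingFactorial (a + k) n) +
          ∑' k : ℕ, nbWeight p a k * (k * risingFactorial (a + k) n) := by
      rw [← tsum_mul_left, ← ((hs n).mul_left _).tsum_add (hs' n)]
      refine tsum_congr fun k => ?_
      rw [risingFactorial_succ]
      ring
    rw [h1, ih] at h2
    have h3 : (1 - p) ≠ 0 := by linarith
    rw [risingFactorial_succ, pow_succ, eq_div_iff (by positivity)]
    rw [← sub_eq_iff_eq_add, ← one_sub_mul] at h2
    calc _ = ((1 - p) * ∑' k : ℕ, nbWeight p a k * risingFactorial (a + k) (n + 1)) *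
          (1 - p) ^ n := by ring
      _ = _ := by rw [h2]; field_simp

/-- Summation by parts, as for a Rodrigues formula: the Meixner polynomial acts on P as an n-th
forward difference. Differences kill degrees below n and send x^n to n!, which gives both
orthogonality and norm. -/
theorem tsum_nbWeight_mul_meixner {p : ℝ} (hp0 : 0 < p) (hp1 : p < 1) {a : ℝ} (ha : 0 ≤ a)
    (n : ℕ) (P : Polynomial ℝ) :
    ∑' k : ℕ, nbWeight p a k * (meixner p a n k * P.eval (k : ℝ)) =
      ∑' k : ℕ, nbWeight p a k *
        (risingFactorial (a + k) n / (n ! : ℝ) * ((fwdDiff 1)^[n] (fun x : ℝ => P.eval x) k)) := by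
  have hterm : ∀ ij ∈ Finset.HasAntidiagonal.antidiagonal n, HasSum (fun k : ℕ => nbWeight p a k *
      ((risingFactorial (-k) ij.1 / (ij.1 ! : ℝ) * (-p⁻¹) ^ ij.1) *
        (risingFactorial (a + k) ij.2 / (ij.2 ! : ℝ) * (-1) ^ ij.2) * P.eval (k : ℝ)))
      (∑' k : ℕ, nbWeight p a k * risingFactorial (a + k) n *
        ((-1) ^ ij.2 / ((ij.1 ! : ℝ) * (ij.2 ! : ℝ))) * P.eval ((k : ℝ) + ij.1)) := by
    rintro ⟨i, j⟩ hij
    have hij : i + j = n := Finset.HasAntidiagonal.mem_antidiagonal.1 hij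
    obtain ⟨R, hR⟩ := exists_polynomial_risingFactorial a n
    have hsum : Summable (fun k : ℕ => nbWeight p a k * risingFactorial (a + k) n *
        ((-1) ^ j / ((i ! : ℝ) * (j ! : ℝ))) * P.eval ((k : ℝ) + i)) := by
      have := summable_nbWeight_mul_eval hp0 hp1 ha (R * P.comp (Polynomial.X + Polynomial.C (i:ℝ)))
      refine (this.mul_left ((-1) ^ j / ((i ! : ℝ) * (j ! : ℝ)))).congr fun k => ?_
      simp [hR]
      ring
    -- The first i terms vanish, so the sum may start at k = i and be shifted.
    refine (hasSum_nat_add_iff' i).1 ?_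
    rw [Finset.sum_eq_zero fun k hk => by
      rw [risingFactorial_neg_natCast_of_lt (Finset.mem_range.1 hk)]; simp, sub_zero]
    convert! hsum.hasSum using 2 with k
    have := nbWeight_add_mul hp0 a k i j
    rw [← mul_assoc, this, hij]
    push_cast
    rfl
  have h1 := hasSum_sum hterm
  have e1 : ∀ k : ℕ, nbWeight p a k * (meixner p a n k * P.eval (k : ℝ)) =
      ∑ ij ∈ Finset.HasAntidiagonal.antidiagonal n, nbWeight p a k *
      ((risingFactorial (-k) ij.1 / (ij.1 ! : ℝ) * (-p⁻¹) ^ ij.1) *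
        (risingFactorial (a + k) ij.2 / (ij.2 ! : ℝ) * (-1) ^ ij.2) * P.eval (k : ℝ)) := fun k => by
    rw [meixner_eq, Finset.sum_mul, Finset.mul_sum]
  simp only [e1]
  rw [h1.tsum_eq, ← Summable.tsum_finsetSum]
  · refine tsum_congr fun k => ?_
    rw [fwdDiff_iter_eq_sum_shift, Finset.mul_sum, Finset.mul_sum,
      Finset.Nat.sum_antidiagonal_eq_sum_range_succ_mk]
    refine Finset.sum_congr rfl fun i hi => ?_
    have hi : i ≤ n := Nat.lt_succ_iff.1 (Finset.mem_range.1 hi)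
    rw [zsmul_eq_mul]
    push_cast
    rw [Nat.cast_choose ℝ hi, nsmul_eq_mul, mul_one]
    have h3 : (n ! : ℝ) ≠ 0 := by positivity
    field_simp
  · rintro ⟨i, j⟩ hij
    obtain ⟨R, hR⟩ := exists_polynomial_risingFactorial a n
    have := summable_nbWeight_mul_eval hp0 hp1 ha (R * P.comp (Polynomial.X + Polynomial.C (i:ℝ)))
    refine (this.mul_left ((-1) ^ j / ((i ! : ℝ) * (j ! : ℝ)))).congr fun k => ?_
    simp [hR]
    ring

theorem tsum_nbWeight_mul_meixner_mul_pow_of_lt {p : ℝ} (hp0 : 0 < p) (hp1 : p < 1) {a : ℝ}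
    (ha : 0 ≤ a) {n l : ℕ} (h : l < n) :
    ∑' k : ℕ, nbWeight p a k * (meixner p a n k * (k : ℝ) ^ l) = 0 := by
  have := tsum_nbWeight_mul_meixner hp0 hp1 ha n (Polynomial.X ^ l)
  simp only [Polynomial.eval_pow, Polynomial.eval_X] at this
  rw [this, fwdDiff_iter_pow_eq_zero_of_lt h]
  simp

theorem tsum_nbWeight_mul_meixner_mul_pow_self {p : ℝ} (hp0 : 0 < p) (hp1 : p < 1) {a : ℝ}
    (ha : 0 ≤ a) (hsum : ∑' k, nbWeight p a k = 1) (n : ℕ) :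
    ∑' k : ℕ, nbWeight p a k * (meixner p a n k * (k : ℝ) ^ n) =
      risingFactorial a n / (1 - p) ^ n := by
  have := tsum_nbWeight_mul_meixner hp0 hp1 ha n (Polynomial.X ^ n)
  simp only [Polynomial.eval_pow, Polynomial.eval_X] at this
  rw [this, fwdDiff_iter_eq_factorial, ← tsum_nbWeight_mul_risingFactorial hp0 hp1 ha hsum]
  refine tsum_congr fun k => ?_
  have h3 : (n ! : ℝ) ≠ 0 := by positivity
  simp only [Pi.natCast_apply]
  field_simp

end

/-! ### Polynomially growing functionals and moments of the Pascal process. -/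

section

variable {E : Type*} [MeasurableSpace E]

instance (η : CountingMeasure E) : IsFiniteMeasure η.1 := by
  obtain ⟨k, hk⟩ := η.2 Set.univ MeasurableSet.univ
  exact ⟨hk ▸ ENNReal.natCast_lt_top k⟩

theorem exists_real_eq_natCast (η : CountingMeasure E) {B : Set E} (hB : MeasurableSet B) :
    ∃ k : ℕ, η.1.real B = k := by
  obtain ⟨k, hk⟩ := η.2 B hB
  exact ⟨k, by simp [Measure.real, hk]⟩

theorem measurable_eval {B : Set E} (hB : MeasurableSet B) :
    Measurable fun η : CountingMeasure E => η.1 B :=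
  (Measure.measurable_coe hB).comp measurable_subtype_coe

theorem measurable_real {B : Set E} (hB : MeasurableSet B) :
    Measurable fun η : CountingMeasure E => η.1.real B :=
  (measurable_eval hB).ennreal_toReal

theorem measurable_pi_power (n : ℕ) :
    Measurable fun η : CountingMeasure E => Measure.pi (fun _ : Fin n => η.1) := by
  refine Measurable.measure_of_isPiSystem generateFrom_pi.symm isPiSystem_pi ?_ ?_
  · rintro _ ⟨A, hA, rfl⟩
    simp only [Measure.pi_pi]
    exact Finset.measurable_prod _ fun i _ => measurable_eval (hA i (Set.mem_univ i))
  · simp only [Measure.pi_univ]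
    exact Finset.measurable_prod _ fun i _ => measurable_eval MeasurableSet.univ

theorem measurable_monomial {n : ℕ} {f : (Fin n → E) → ℝ} (hf : Measurable f) :
    Measurable (monomial n f) := by
  let κ : Kernel (CountingMeasure E) (Fin n → E) := ⟨_, measurable_pi_power n⟩
  have hκ : ∀ η, IsFiniteMeasure (κ η) := fun η => by
    change IsFiniteMeasure (Measure.pi _); infer_instance
  have hs : IsSFiniteKernel κ := by
    -- The total mass is not bounded in η; cutting according to its integer part gives countably
    -- many finite kernels.
    refine ⟨⟨fun k => ⟨fun η => if ⌊(κ η).real Set.univ⌋₊ = k then κ η else 0, ?_⟩, ?_, ?_⟩⟩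
    · refine Measurable.ite ?_ κ.measurable measurable_const
      exact (Nat.measurable_floor.comp (κ.measurable_coe MeasurableSet.univ).ennreal_toReal)
        (measurableSet_singleton k)
    · refine fun k => ⟨⟨k + 1, by simp, fun η => ?_⟩⟩
      change (if _ then κ η else 0) Set.univ ≤ _
      split_ifs with h
      · have := (Nat.lt_floor_add_one ((κ η).real Set.univ)).le
        rw [h] at this
        rw [← ENNReal.ofReal_toReal (measure_ne_top (κ η) Set.univ)]
        refine (ENNReal.ofReal_le_ofReal this).trans_eq ?_
        rw [ENNReal.ofReal_add (by positivity) zero_le_one]; simp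
      · simp
    · ext η s hs
      rw [Kernel.sum_apply' _ _ hs, tsum_eq_single ⌊(κ η).real Set.univ⌋₊]
      · change _ = (if _ then κ η else 0) s
        simp
      · intro k hk
        change (if _ then κ η else 0) s = 0
        rw [if_neg hk.symm]; simp
  exact (hf.stronglyMeasurable.integral_kernel (κ := κ)).measurable

/-- Measurable functions of a finite counting measure that grow at most polynomially in the
number of points. -/
def IsTame (F : CountingMeasure E → ℝ) : Prop :=
  Measurable F ∧ ∃ (C : ℝ) (k : ℕ), ∀ η, |F η| ≤ C * (1 + η.1.real Set.univ) ^ k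

namespace IsTame

variable {F G : CountingMeasure E → ℝ}

theorem const (c : ℝ) : IsTame fun _ : CountingMeasure E => c :=
  ⟨measurable_const, |c|, 0, fun η => by simp⟩

theorem add (hF : IsTame F) (hG : IsTame G) : IsTame fun η => F η + G η := by
  obtain ⟨hFm, C, k, hC⟩ := hF
  obtain ⟨hGm, D, l, hD⟩ := hG
  refine ⟨hFm.add hGm, |C| + |D|, k + l, fun η => (abs_add_le _ _).trans ?_⟩
  have h1 : (1 : ℝ) ≤ 1 + η.1.real Set.univ := by simp
  rw [add_mul]
  refine add_le_add ((hC η).trans ?_) ((hD η).trans ?_)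
  · exact mul_le_mul (le_abs_self C) (pow_le_pow_right₀ h1 (by omega)) (by positivity)
      (abs_nonneg _)
  · exact mul_le_mul (le_abs_self D) (pow_le_pow_right₀ h1 (by omega)) (by positivity)
      (abs_nonneg _)

theorem mul (hF : IsTame F) (hG : IsTame G) : IsTame fun η => F η * G η := by
  obtain ⟨hFm, C, k, hC⟩ := hF
  obtain ⟨hGm, D, l, hD⟩ := hG
  refine ⟨hFm.mul hGm, C * D, k + l, fun η => ?_⟩
  rw [abs_mul, pow_add]
  refine (mul_le_mul (hC η) (hD η) (abs_nonneg _) ((abs_nonneg _).trans (hC η))).trans_eq ?_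
  ring

theorem const_mul (c : ℝ) (hF : IsTame F) : IsTame fun η => c * F η := (const c).mul hF

theorem pow (hF : IsTame F) (k : ℕ) : IsTame fun η => F η ^ k := by
  induction k with
  | zero => simpa using const 1
  | succ k ih => simpa [pow_succ] using ih.mul hF

theorem sum {ι : Type*} (s : Finset ι) {F : ι → CountingMeasure E → ℝ}
    (h : ∀ i ∈ s, IsTame (F i)) : IsTame fun η => ∑ i ∈ s, F i η := by
  classical
  induction s using Finset.induction_on with
  | empty => simpa using const 0
  | insert a s ha ih =>
    simp only [Finset.sum_insert ha]
    exact (h a (Finset.mem_insert_self _ _)).add (ih fun i hi => h i (Finset.mem_insert_of_mem hi))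

theorem prod {ι : Type*} (s : Finset ι) {F : ι → CountingMeasure E → ℝ}
    (h : ∀ i ∈ s, IsTame (F i)) : IsTame fun η => ∏ i ∈ s, F i η := by
  classical
  induction s using Finset.induction_on with
  | empty => simpa using const 1
  | insert a s ha ih =>
    simp only [Finset.prod_insert ha]
    exact (h a (Finset.mem_insert_self _ _)).mul (ih fun i hi => h i (Finset.mem_insert_of_mem hi))

theorem real {B : Set E} (hB : MeasurableSet B) :
    IsTame fun η : CountingMeasure E => η.1.real B :=
  ⟨measurable_real hB, 1, 1, fun η => by
    rw [abs_of_nonneg measureReal_nonneg, one_mul, pow_one]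
    exact (measureReal_mono (Set.subset_univ _)).trans (by linarith)⟩

theorem eval (P : Polynomial ℝ) (hF : IsTame F) : IsTame fun η => P.eval (F η) := by
  simp only [Polynomial.eval_eq_sum_range]
  exact sum _ fun i _ => (hF.pow i).const_mul _

theorem monomial {n : ℕ} {f : (Fin n → E) → ℝ} (hf : IsBddMeas f) :
    IsTame (monomial n f) := by
  obtain ⟨hm, C, hC⟩ := hf
  refine ⟨measurable_monomial hm, |C|, n, fun η => ?_⟩
  have := norm_integral_le_of_norm_le_const (μ := Measure.pi (fun _ : Fin n => η.1)) (f := f)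
    (C := |C|) (Filter.Eventually.of_forall fun x => (hC x).trans (le_abs_self C))
  refine this.trans (mul_le_mul_of_nonneg_left ?_ (abs_nonneg _))
  rw [Measure.real, Measure.pi_univ, Finset.prod_const, ENNReal.toReal_pow, Finset.card_univ,
    Fintype.card_fin]
  exact pow_le_pow_left₀ (by positivity) (by simp [Measure.real]) _

end IsTame

variable {p : ℝ} {α : Measure E} {ρ : Measure (CountingMeasure E)}

/-- Counts are integers, so the floor loses nothing and gives an ℕ-valued variable, whose law is a
sum of point masses. -/
theorem measurable_floor_real {B : Set E} (hB : MeasurableSet B) :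
    Measurable fun η : CountingMeasure E => ⌊η.1.real B⌋₊ :=
  Nat.measurable_floor.comp (measurable_real hB)

theorem floor_real (η : CountingMeasure E) {B : Set E} (hB : MeasurableSet B) :
    (⌊η.1.real B⌋₊ : ℝ) = η.1.real B := by
  obtain ⟨k, hk⟩ := exists_real_eq_natCast η hB
  rw [hk, Nat.floor_natCast]

theorem IsPascal.map_floor_real_singleton (hp0 : 0 < p) (hp1 : p < 1) (hρ : IsPascal p α ρ)
    {B : Set E} (hB : MeasurableSet B) (k : ℕ) :
    (ρ.map fun η => ⌊η.1.real B⌋₊).real {k} = nbWeight p (α.real B) k := by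
  rw [Measure.real, Measure.map_apply (measurable_floor_real hB) (measurableSet_singleton k)]
  have : (fun η : CountingMeasure E => ⌊η.1.real B⌋₊) ⁻¹' {k} = {η | η.1 B = (k : ℝ≥0∞)} := by
    ext η
    obtain ⟨l, hl⟩ := η.2 B hB
    simp [Measure.real, hl]
  rw [this, hρ.law B hB k]
  exact ENNReal.toReal_ofReal (nbWeight_nonneg hp0 hp1 measureReal_nonneg k)

/-- The weights sum to one because they are the law of a count under a probability measure; no
binomial series is needed. -/
theorem IsPascal.tsum_nbWeight (hp0 : 0 < p) (hp1 : p < 1) (hρ : IsPascal p α ρ)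
    {B : Set E} (hB : MeasurableSet B) : ∑' k, nbWeight p (α.real B) k = 1 := by
  have := hρ.isProbabilityMeasure
  have := Measure.isProbabilityMeasure_map (μ := ρ) (measurable_floor_real hB).aemeasurable
  have h := integral_countable (μ := ρ.map fun η => ⌊η.1.real B⌋₊)
    (f := fun _ => (1 : ℝ)) (integrable_const _)
  simp only [hρ.map_floor_real_singleton hp0 hp1 hB, smul_eq_mul, mul_one] at h
  rw [← h]; simp

theorem IsPascal.integrable_comp_real (hp0 : 0 < p) (hp1 : p < 1) (hρ : IsPascal p α ρ)
    {B : Set E} (hB : MeasurableSet B) {F : ℝ → ℝ}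
    (hF : Summable fun k : ℕ => nbWeight p (α.real B) k * |F k|) :
    Integrable (fun η => F (η.1.real B)) ρ ∧
      ∫ η, F (η.1.real B) ∂ρ = ∑' k : ℕ, nbWeight p (α.real B) k * F k := by
  have := hρ.isProbabilityMeasure
  have := Measure.isProbabilityMeasure_map (μ := ρ) (measurable_floor_real hB).aemeasurable
  have hi : Integrable (fun k : ℕ => F k) (ρ.map fun η => ⌊η.1.real B⌋₊) := by
    rw [← Measure.sum_smul_dirac (ρ.map fun η => ⌊η.1.real B⌋₊)]
    refine integrable_sum_dirac (fun i => measure_ne_top _ _) ?_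
    refine hF.congr fun k => ?_
    rw [← hρ.map_floor_real_singleton hp0 hp1 hB k]; rfl
  have h := integral_countable hi
  rw [integral_map (measurable_floor_real hB).aemeasurable hi.aestronglyMeasurable] at h
  have hi' := hi.comp_measurable (measurable_floor_real hB)
  simp only [Function.comp_def, floor_real _ hB] at hi' h
  refine ⟨hi', h.trans (tsum_congr fun k => ?_)⟩
  rw [hρ.map_floor_real_singleton hp0 hp1 hB k, smul_eq_mul]

theorem IsTame.integrable (hp0 : 0 < p) (hp1 : p < 1) (hρ : IsPascal p α ρ)
    {F : CountingMeasure E → ℝ} (hF : IsTame F) : Integrable F ρ := by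
  obtain ⟨hm, C, k, hC⟩ := hF
  have h := (hρ.integrable_comp_real hp0 hp1 MeasurableSet.univ
    (F := fun x => (1 + x) ^ k) ?_).1.const_mul C
  · exact h.mono' hm.aestronglyMeasurable (Filter.Eventually.of_forall hC)
  · have := summable_nbWeight_mul_eval hp0 hp1 (measureReal_nonneg (μ := α) (s := Set.univ))
      ((1 + Polynomial.X) ^ k)
    refine this.congr fun m => ?_
    rw [abs_of_nonneg (by positivity)]
    simp

theorem IsTame.memLp (hp0 : 0 < p) (hp1 : p < 1) (hρ : IsPascal p α ρ)
    {F : CountingMeasure E → ℝ} (hF : IsTame F) : MemLp F 2 ρ :=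
  (memLp_two_iff_integrable_sq hF.1.aestronglyMeasurable).2 ((hF.pow 2).integrable hp0 hp1 hρ)

theorem IsPascal.integral_eval (hp0 : 0 < p) (hp1 : p < 1) (hρ : IsPascal p α ρ)
    {B : Set E} (hB : MeasurableSet B) {F : ℝ → ℝ} {P : Polynomial ℝ} (hF : ∀ x, F x = P.eval x) :
    ∫ η, F (η.1.real B) ∂ρ = ∑' k : ℕ, nbWeight p (α.real B) k * F k := by
  refine (hρ.integrable_comp_real hp0 hp1 hB ?_).2
  simp only [hF]
  refine (summable_nbWeight_mul_eval hp0 hp1 (measureReal_nonneg (μ := α) (s := B)) P).abs.congr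
    fun k => ?_
  rw [abs_mul, abs_of_nonneg (nbWeight_nonneg hp0 hp1 measureReal_nonneg k)]

theorem IsPascal.integral_meixner_mul_pow_of_lt (hp0 : 0 < p) (hp1 : p < 1)
    (hρ : IsPascal p α ρ) {B : Set E} (hB : MeasurableSet B) {n l : ℕ} (h : l < n) :
    ∫ η, meixner p (α.real B) n (η.1.real B) * η.1.real B ^ l ∂ρ = 0 := by
  obtain ⟨P, hP⟩ := exists_polynomial_meixner p (α.real B) n
  rw [hρ.integral_eval hp0 hp1 hB (F := fun x => meixner p (α.real B) n x * x ^ l)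
    (P := P * Polynomial.X ^ l) (by simp [hP])]
  exact tsum_nbWeight_mul_meixner_mul_pow_of_lt hp0 hp1 measureReal_nonneg h

theorem IsPascal.integral_meixner_mul_pow_self (hp0 : 0 < p) (hp1 : p < 1)
    (hρ : IsPascal p α ρ) {B : Set E} (hB : MeasurableSet B) (n : ℕ) :
    ∫ η, meixner p (α.real B) n (η.1.real B) * η.1.real B ^ n ∂ρ =
      risingFactorial (α.real B) n / (1 - p) ^ n := by
  obtain ⟨P, hP⟩ := exists_polynomial_meixner p (α.real B) n
  rw [hρ.integral_eval hp0 hp1 hB (F := fun x => meixner p (α.real B) n x * x ^ n)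
    (P := P * Polynomial.X ^ n) (by simp [hP])]
  exact tsum_nbWeight_mul_meixner_mul_pow_self hp0 hp1 measureReal_nonneg
    (hρ.tsum_nbWeight hp0 hp1 hB) n

/-- Products of Meixner polynomials of the counts in disjoint sets are orthogonal to products of
powers of these counts. -/
theorem IsPascal.integral_prod_meixner_mul_pow (hρ : IsPascal p α ρ) {m : ℕ}
    {C : Fin m → Set E} (hC : ∀ c, MeasurableSet (C c))
    (hd : Pairwise fun i j => Disjoint (C i) (C j)) (k l : Fin m → ℕ) :
    ∫ η, ∏ c, (meixner p (α.real (C c)) (k c) (η.1.real (C c)) * η.1.real (C c) ^ l c) ∂ρ =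
      ∏ c, ∫ η, meixner p (α.real (C c)) (k c) (η.1.real (C c)) * η.1.real (C c) ^ l c ∂ρ := by
  have h := (hρ.indep m C hC hd).integral_fun_prod_comp (𝕜 := ℝ)
    (f := fun c x => meixner p (α.real (C c)) (k c) x.toReal * x.toReal ^ l c)
    (fun c => (measurable_eval (hC c)).aemeasurable) fun c => ?_
  · exact h
  · obtain ⟨P, hP⟩ := exists_polynomial_meixner p (α.real (C c)) (k c)
    simp only [hP]
    exact ((P.continuous.measurable.comp ENNReal.measurable_toReal).mul
      (ENNReal.measurable_toReal.pow_const _)).aestronglyMeasurable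

end

/-! ### Generating function over a finite partition into cells. -/

section

variable {E : Type*} [MeasurableSpace E]

/-- A finite measurable partition of `E`, with labelled and possibly empty cells. -/
structure IsCells {m : ℕ} (C : Fin m → Set E) : Prop where
  measurableSet : ∀ c, MeasurableSet (C c)
  disjoint : Pairwise fun i j => Disjoint (C i) (C j)
  exists_mem : ∀ x, ∃ c, x ∈ C c

/-- The cells are the joint level sets of u and v. -/
theorem exists_isCells {u v : E → ℝ} (hu : Measurable u) (hv : Measurable v)
    (hu' : (Set.range u).Finite) (hv' : (Set.range v).Finite) :
    ∃ (m : ℕ) (C : Fin m → Set E) (a b : Fin m → ℝ), IsCells C ∧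
      (∀ c, ∀ x ∈ C c, u x = a c) ∧ ∀ c, ∀ x ∈ C c, v x = b c := by
  let Z := hu'.toFinset ×ˢ hv'.toFinset
  refine ⟨Z.card, fun c => u ⁻¹' {(Z.equivFin.symm c).1.1} ∩ v ⁻¹' {(Z.equivFin.symm c).1.2},
    fun c => (Z.equivFin.symm c).1.1, fun c => (Z.equivFin.symm c).1.2, ⟨fun c => ?_, ?_, ?_⟩,
    fun c x hx => hx.1, fun c x hx => hx.2⟩
  · exact (hu (measurableSet_singleton _)).inter (hv (measurableSet_singleton _))
  · intro i j hij
    refine Set.disjoint_left.2 fun x hx hx' => hij ?_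
    refine Z.equivFin.symm.injective (Subtype.ext (Prod.ext ?_ ?_))
    · exact hx.1.symm.trans hx'.1
    · exact hx.2.symm.trans hx'.2
  · intro x
    have hx : (u x, v x) ∈ Z := by simp [Z]
    exact ⟨Z.equivFin ⟨_, hx⟩, by simp⟩

theorem IsCells.integral_eq {m : ℕ} {C : Fin m → Set E} (hC : IsCells C) (μ : Measure E)
    [IsFiniteMeasure μ] {w : E → ℝ} {a : Fin m → ℝ} (hw : ∀ c, ∀ x ∈ C c, w x = a c) :
    ∫ x, w x ∂μ = ∑ c, μ.real (C c) * a c := by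
  have h : w = fun x => ∑ c, (C c).indicator (fun _ => a c) x := by
    ext x
    obtain ⟨c, hc⟩ := hC.exists_mem x
    rw [Finset.sum_eq_single c, Set.indicator_of_mem hc, hw c x hc]
    · intro d _ hd
      exact Set.indicator_of_notMem (fun h => Set.disjoint_left.1 (hC.disjoint hd) h hc) _
    · simp
  rw [h, integral_finsetSum]
  · refine Finset.sum_congr rfl fun c _ => ?_
    rw [integral_indicator_const _ (hC.measurableSet c), smul_eq_mul]
  · exact fun c _ => (integrable_const _).indicator (hC.measurableSet c)

/-- The coefficients of the generating function
`exp (∫ log (1 + t u / p) dη - ∫ log (1 + t u) d(α + η))`. -/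
def chaosPoly (p : ℝ) (α : Measure E) (u : E → ℝ) (n : ℕ) (η : CountingMeasure E) : ℝ :=
  expCoeff (fun k => (-1) ^ k * (p⁻¹ ^ (k + 1) * ∫ x, u x ^ (k + 1) ∂η.1 -
    (∫ x, u x ^ (k + 1) ∂α + ∫ x, u x ^ (k + 1) ∂η.1))) n

theorem IsCells.chaosPoly_eq {m : ℕ} {C : Fin m → Set E} (hC : IsCells C) (p : ℝ)
    (α : Measure E) [IsFiniteMeasure α] {u : E → ℝ} {a : Fin m → ℝ}
    (hu : ∀ c, ∀ x ∈ C c, u x = a c) (n : ℕ) (η : CountingMeasure E) :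
    chaosPoly p α u n η = ∑ l ∈ Finset.finsuppAntidiag Finset.univ n,
      ∏ c, (a c ^ l c * meixner p (α.real (C c)) (l c) (η.1.real (C c))) := by
  -- Each cell contributes two factors, (1 + a t / p)^η(C) and (1 + a t)^(-(α(C) + η(C))); their
  -- product generates the Meixner polynomials of the cell.
  have h := coeff_prod_riseSeries (Finset.univ : Finset (Fin m ⊕ Fin m))
    (Sum.elim (fun c => -(a c * p⁻¹)) fun c => -a c)
    (Sum.elim (fun c => -η.1.real (C c)) fun c => α.real (C c) + η.1.real (C c)) n
  simp only [Fintype.prod_sum_type, Sum.elim_inl, Sum.elim_inr, Fintype.sum_sum_type,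
    ← Finset.prod_mul_distrib] at h
  rw [PowerSeries.coeff_prod] at h
  simp only [coeff_riseSeries_mul_riseSeries] at h
  rw [h, chaosPoly]
  congr 1
  ext k
  have hk : ∀ c, ∀ x ∈ C c, u x ^ (k + 1) = a c ^ (k + 1) := fun c x hx => by rw [hu c x hx]
  rw [hC.integral_eq η.1 hk, hC.integral_eq α hk, ← Finset.sum_add_distrib, Finset.mul_sum,
    ← Finset.sum_sub_distrib, Finset.mul_sum, ← Finset.sum_add_distrib]
  refine Finset.sum_congr rfl fun c _ => ?_
  rw [neg_pow (a c * p⁻¹), neg_pow (a c), mul_pow, pow_succ (-1 : ℝ)]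
  ring

theorem exists_lt_of_sum_lt_or_ne {m : ℕ} {l k : Fin m → ℕ}
    (h : ∑ c, k c < ∑ c, l c ∨ (∑ c, k c = ∑ c, l c ∧ k ≠ l)) : ∃ c, k c < l c := by
  by_contra! hle
  have h1 := Finset.sum_le_sum fun c (_ : c ∈ Finset.univ) => hle c
  rcases h with h | ⟨h, hne⟩
  · omega
  · exact hne (funext fun c =>
      ((Finset.sum_eq_sum_iff_of_le fun c _ => hle c).1 h.symm c (Finset.mem_univ c)).symm)

variable {p : ℝ} {α : Measure E} {ρ : Measure (CountingMeasure E)}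

/-- If the total power is smaller, or equal with different exponents, some cell has power below its
Meixner degree, and its independent factor has mean zero. -/
theorem IsPascal.integral_prod_eq_zero (hp0 : 0 < p) (hp1 : p < 1) (hρ : IsPascal p α ρ)
    {m : ℕ} {C : Fin m → Set E} (hC : IsCells C) {l k : Fin m → ℕ}
    (h : ∑ c, k c < ∑ c, l c ∨ (∑ c, k c = ∑ c, l c ∧ k ≠ l)) :
    ∫ η, ∏ c, (meixner p (α.real (C c)) (l c) (η.1.real (C c)) * η.1.real (C c) ^ k c) ∂ρ = 0 := by
  obtain ⟨c, hc⟩ := exists_lt_of_sum_lt_or_ne h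
  rw [hρ.integral_prod_meixner_mul_pow hC.measurableSet hC.disjoint]
  exact Finset.prod_eq_zero (Finset.mem_univ c)
    (hρ.integral_meixner_mul_pow_of_lt hp0 hp1 (hC.measurableSet c) hc)

theorem IsPascal.integral_chaosPoly_mul_pow (hp0 : 0 < p) (hp1 : p < 1)
    (hρ : IsPascal p α ρ) [IsFiniteMeasure α] {m : ℕ} {C : Fin m → Set E} (hC : IsCells C)
    {u v : E → ℝ} {a b : Fin m → ℝ} (hu : ∀ c, ∀ x ∈ C c, u x = a c)
    (hv : ∀ c, ∀ x ∈ C c, v x = b c) (n k : ℕ) :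
    ∫ η, chaosPoly p α u n η * (∫ x, v x ∂η.1) ^ k ∂ρ =
      ∑ l ∈ Finset.finsuppAntidiag Finset.univ n, ∑ j ∈ Finset.piAntidiag Finset.univ k,
        (∏ c, a c ^ l c) * (Nat.multinomial Finset.univ j * ∏ c, b c ^ j c) *
        ∫ η, ∏ c, (meixner p (α.real (C c)) (l c) (η.1.real (C c)) *
          η.1.real (C c) ^ j c) ∂ρ := by
  have e : ∀ η : CountingMeasure E, chaosPoly p α u n η * (∫ x, v x ∂η.1) ^ k =
      ∑ l ∈ Finset.finsuppAntidiag Finset.univ n, ∑ j ∈ Finset.piAntidiag Finset.univ k,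
        (∏ c, a c ^ l c) * (Nat.multinomial Finset.univ j * ∏ c, b c ^ j c) *
        ∏ c, (meixner p (α.real (C c)) (l c) (η.1.real (C c)) * η.1.real (C c) ^ j c) := by
    intro η
    rw [hC.chaosPoly_eq p α hu, hC.integral_eq η.1 hv, Finset.sum_pow_eq_sum_piAntidiag,
      Finset.sum_mul_sum]
    refine Finset.sum_congr rfl fun l _ => Finset.sum_congr rfl fun j _ => ?_
    simp only [mul_pow, Finset.prod_mul_distrib]
    ring
  have ht : ∀ l j : Fin m → ℕ, IsTame fun η : CountingMeasure E =>
      ∏ c, (meixner p (α.real (C c)) (l c) (η.1.real (C c)) * η.1.real (C c) ^ j c) := by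
    refine fun l j => IsTame.prod _ fun c _ => ?_
    obtain ⟨P, hP⟩ := exists_polynomial_meixner p (α.real (C c)) (l c)
    simp only [hP]
    exact ((IsTame.real (hC.measurableSet c)).eval P).mul ((IsTame.real (hC.measurableSet c)).pow _)
  simp only [e]
  rw [integral_finsetSum]
  · refine Finset.sum_congr rfl fun l _ => ?_
    rw [integral_finsetSum]
    · exact Finset.sum_congr rfl fun j _ => integral_const_mul _ _
    · exact fun j _ => ((ht l j).const_mul _).integrable hp0 hp1 hρ
  · exact fun l _ => (IsTame.sum _ fun j _ => (ht l j).const_mul _).integrable hp0 hp1 hρ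

theorem IsPascal.integral_chaosPoly_mul_pow_of_lt (hp0 : 0 < p) (hp1 : p < 1)
    (hρ : IsPascal p α ρ) [IsFiniteMeasure α] {u v : E → ℝ} (hu : Measurable u)
    (hv : Measurable v) (hu' : (Set.range u).Finite) (hv' : (Set.range v).Finite) {n k : ℕ}
    (h : k < n) :
    ∫ η, chaosPoly p α u n η * (∫ x, v x ∂η.1) ^ k ∂ρ = 0 := by
  obtain ⟨m, C, a, b, hC, ha, hb⟩ := exists_isCells hu hv hu' hv'
  rw [hρ.integral_chaosPoly_mul_pow hp0 hp1 hC ha hb]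
  refine Finset.sum_eq_zero fun l hl => Finset.sum_eq_zero fun j hj => ?_
  rw [Finset.mem_finsuppAntidiag] at hl
  rw [Finset.mem_piAntidiag] at hj
  rw [hρ.integral_prod_eq_zero hp0 hp1 hC (Or.inl (by rw [hj.1, hl.1]; exact h)), mul_zero]

theorem IsPascal.integral_chaosPoly_mul_pow_self (hp0 : 0 < p) (hp1 : p < 1)
    (hρ : IsPascal p α ρ) [IsFiniteMeasure α] {u v : E → ℝ} (hu : Measurable u)
    (hv : Measurable v) (hu' : (Set.range u).Finite) (hv' : (Set.range v).Finite) (n : ℕ) :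
    ∫ η, chaosPoly p α u n η * (∫ x, v x ∂η.1) ^ n ∂ρ =
      (n ! : ℝ) / (1 - p) ^ n * expCoeff (fun k => ∫ x, (u x * v x) ^ (k + 1) ∂α) n := by
  obtain ⟨m, C, a, b, hC, ha, hb⟩ := exists_isCells hu hv hu' hv'
  have h1 := coeff_prod_riseSeries (Finset.univ : Finset (Fin m)) (fun c => a c * b c)
    (fun c => α.real (C c)) n
  rw [PowerSeries.coeff_prod] at h1
  have h2 : (fun k => ∫ x, (u x * v x) ^ (k + 1) ∂α) =
      fun k => ∑ c, α.real (C c) * (a c * b c) ^ (k + 1) := by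
    ext k
    exact hC.integral_eq α fun c x hx => by rw [ha c x hx, hb c x hx]
  rw [h2, ← h1, hρ.integral_chaosPoly_mul_pow hp0 hp1 hC ha hb, Finset.mul_sum]
  refine Finset.sum_congr rfl fun l hl => ?_
  rw [Finset.mem_finsuppAntidiag] at hl
  have hl1 : ∑ c, l c = n := hl.1
  -- Only j = l survives; its multinomial coefficient n! / ∏ l_c! supplies the denominators of the
  -- binomial series.
  rw [Finset.sum_eq_single (l : Fin m → ℕ)]
  · rw [hρ.integral_prod_meixner_mul_pow hC.measurableSet hC.disjoint]
    simp only [hρ.integral_meixner_mul_pow_self hp0 hp1 (hC.measurableSet _), coeff_riseSeries]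
    have h3 := Nat.multinomial_spec (Finset.univ : Finset (Fin m)) (l : Fin m → ℕ)
    rw [hl1] at h3
    have h4 : (Nat.multinomial Finset.univ (l : Fin m → ℕ) : ℝ) =
        (n ! : ℝ) / ∏ c, ((l c)! : ℝ) := by
      rw [eq_div_iff (Finset.prod_ne_zero_iff.2 fun c _ => by positivity), ← h3]
      push_cast; ring
    have h5 : (1 - p) ^ n = ∏ c, (1 - p) ^ l c := by rw [Finset.prod_pow_eq_pow_sum, hl1]
    rw [h4, h5]
    simp only [mul_pow, Finset.prod_mul_distrib, Finset.prod_div_distrib]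
    ring
  · intro j hj hne
    rw [Finset.mem_piAntidiag] at hj
    rw [hρ.integral_prod_eq_zero hp0 hp1 hC (Or.inr ⟨by rw [hj.1, hl1], hne⟩), mul_zero]
  · intro h
    exact absurd (Finset.mem_piAntidiag.2 ⟨hl1, fun c _ => Finset.mem_univ c⟩) h

end

/-! ### The exponential formula and integration against λ_n. -/

section

/-- Set partitions of `insert a s` in which the block of `a` is `insert a T` correspond to set
partitions of `s \ T`. -/
def finpartitionInsertEquiv {κ : Type*} [DecidableEq κ] {a : κ} {s T : Finset κ} (ha : a ∉ s)
    (hT : T ⊆ s) :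
    {σ : Finpartition (insert a s) // insert a T ∈ σ.parts} ≃ Finpartition (s \ T) where
  toFun σ := σ.1.ofSubset (Finset.erase_subset (insert a T) σ.1.parts) (by
    have h1 := σ.1.sup_parts
    have h2 : σ.1.parts = insert (insert a T) (σ.1.parts.erase (insert a T)) :=
      (Finset.insert_erase σ.2).symm
    have h3 : Disjoint (insert a T) ((σ.1.parts.erase (insert a T)).sup id) :=
      σ.1.supIndep (Finset.erase_subset _ _) σ.2 (Finset.notMem_erase _ _)
    rw [h2, Finset.sup_insert, id, Finset.sup_eq_union] at h1
    ext x
    have h4 := Finset.ext_iff.1 h1 x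
    have h5 : x ∈ insert a T → x ∉ _ := fun h => Finset.disjoint_left.1 h3 h
    simp only [Finset.mem_union, Finset.mem_insert] at h4 h5
    rw [Finset.mem_sdiff]
    constructor
    · intro hx
      have := h4.1 (Or.inr hx)
      tauto
    · rintro ⟨hx, hx'⟩
      have hxa : x ≠ a := fun h => ha (h ▸ hx)
      tauto)
  invFun τ := ⟨τ.extend (b := insert a T) (Finset.insert_ne_empty _ _)
    (by
      rw [Finset.disjoint_left]
      intro x hx hx'
      rw [Finset.mem_sdiff] at hx
      rcases Finset.mem_insert.1 hx' with rfl | h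
      exacts [ha hx.1, hx.2 h])
    (by
      ext x
      have := @hT x
      simp only [Finset.sup_eq_union, Finset.mem_union, Finset.mem_sdiff, Finset.mem_insert]
      tauto), by simp [Finpartition.extend]⟩
  left_inv σ := by
    refine Subtype.ext (Finpartition.ext ?_)
    exact Finset.insert_erase σ.2
  right_inv τ := by
    refine Finpartition.ext ?_
    refine Finset.erase_insert fun h => ?_
    have := τ.le h (Finset.mem_insert_self a T)
    exact ha (Finset.mem_sdiff.1 this).1

/-- Set partitions are sorted by T, the block of a without a itself. -/
theorem sum_finpartition_insert {κ : Type*} [DecidableEq κ] {a : κ} {s : Finset κ} (ha : a ∉ s)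
    (b : ℕ → ℝ) :
    ∑ σ : Finpartition (insert a s), ∏ A ∈ σ.parts, b A.card =
      ∑ T ∈ s.powerset, b (T.card + 1) *
        ∑ σ : Finpartition (s \ T), ∏ A ∈ σ.parts, b A.card := by
  have hmaps : ∀ σ ∈ (Finset.univ : Finset (Finpartition (insert a s))),
      (σ.part a).erase a ∈ s.powerset := fun σ _ => by
    rw [Finset.mem_powerset]
    intro x hx
    have := σ.part_subset a (Finset.mem_of_mem_erase hx)
    exact (Finset.mem_insert.1 this).resolve_left (Finset.ne_of_mem_erase hx)
  rw [← Finset.sum_fiberwise_of_maps_to hmaps]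
  refine Finset.sum_congr rfl fun T hT => ?_
  rw [Finset.mem_powerset] at hT
  have haT : a ∉ T := fun h => ha (hT h)
  have hfil : ∀ σ : Finpartition (insert a s),
      (σ.part a).erase a = T ↔ insert a T ∈ σ.parts := fun σ => by
    have hmem : a ∈ σ.part a := σ.mem_part_self.2 (Finset.mem_insert_self _ _)
    constructor
    · rintro rfl
      rw [Finset.insert_erase hmem]
      exact σ.part_mem.2 (Finset.mem_insert_self _ _)
    · intro h
      rw [σ.part_eq_of_mem h (Finset.mem_insert_self _ _), Finset.erase_insert haT]
  rw [Finset.mul_sum, Finset.filter_congr fun σ _ => hfil σ,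
    Finset.sum_subtype (p := fun σ : Finpartition (insert a s) => insert a T ∈ σ.parts) _
      (fun σ => by simp)]
  refine Fintype.sum_equiv (finpartitionInsertEquiv ha hT) _ _ fun σ => ?_
  have h1 : (finpartitionInsertEquiv ha hT σ).parts = σ.1.parts.erase (insert a T) := rfl
  rw [h1, ← Finset.mul_prod_erase _ _ σ.2, Finset.card_insert_of_notMem haT]

/-- Exponential formula: removing the block of one element gives the recursion of `expCoeff`, since
choosing its k companions costs a binomial coefficient and k! (n - k)! times it is n!. -/
theorem sum_finpartition_eq_expCoeff {κ : Type*} [DecidableEq κ] (ψ : ℕ → ℝ) (n : ℕ) :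
    ∀ s : Finset κ, s.card = n →
      ∑ σ : Finpartition s, ∏ A ∈ σ.parts, (((A.card - 1)! : ℝ) * ψ (A.card - 1)) =
        (n ! : ℝ) * expCoeff ψ n := by
  induction n using Nat.strong_induction_on with
  | _ n ih =>
    intro s hs
    cases n with
    | zero =>
      obtain rfl := Finset.card_eq_zero.1 hs
      have : ∀ σ : Finpartition (∅ : Finset κ), σ.parts = ∅ := fun σ =>
        σ.parts_eq_empty_iff.2 rfl
      have hc : Fintype.card (Finpartition (∅ : Finset κ)) = 1 :=
        Fintype.card_eq_one_iff.2 ⟨Finpartition.empty _, fun σ => Finpartition.ext (by rw [this, this])⟩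
      simp [this, hc]
    | succ n =>
      obtain ⟨a, t, ha, rfl, ht⟩ := Finset.card_eq_succ.1 hs
      rw [sum_finpartition_insert ha (fun k => ((k - 1)! : ℝ) * ψ (k - 1))]
      have h1 : ∀ T ∈ t.powerset, ((T.card + 1 - 1)! : ℝ) * ψ (T.card + 1 - 1) *
          ∑ σ : Finpartition (t \ T), ∏ A ∈ σ.parts, (((A.card - 1)! : ℝ) * ψ (A.card - 1)) =
          (fun k => (k ! : ℝ) * ψ k * (((n - k)! : ℝ) * expCoeff ψ (n - k))) T.card := by
        intro T hT
        rw [Finset.mem_powerset] at hT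
        rw [ih (n - T.card) (by omega) (t \ T) (by rw [Finset.card_sdiff_of_subset hT, ht])]
        simp
      rw [Finset.sum_congr rfl h1, Finset.sum_powerset_apply_card
        (fun k => (k ! : ℝ) * ψ k * (((n - k)! : ℝ) * expCoeff ψ (n - k))), ht, expCoeff_succ,
        ← Finset.sum_range_reflect, Nat.factorial_succ]
      have h0 : (n : ℝ) + 1 ≠ 0 := by positivity
      push_cast
      rw [mul_comm ((n : ℝ) + 1), mul_assoc, mul_div_cancel₀ _ h0, Finset.mul_sum]
      refine Finset.sum_congr rfl fun k hk => ?_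
      have hk : k ≤ n := Nat.lt_succ_iff.1 (Finset.mem_range.1 hk)
      have e2 : n - (n - k) = k := by omega
      rw [e2, nsmul_eq_mul, Nat.cast_choose ℝ (Nat.sub_le n k), e2]
      field_simp

theorem prod_diagonalMap {E : Type*} {n : ℕ} (σ : Finpartition (Finset.univ : Finset (Fin n)))
    (w : E → ℝ) (y : σ.parts → E) :
    ∏ i, w (diagonalMap σ y i) = ∏ A : σ.parts, w (y A) ^ A.1.card := by
  let g : Fin n → σ.parts := fun i => ⟨σ.part i, σ.part_mem.2 (Finset.mem_univ i)⟩
  have h : ∀ i, w (diagonalMap σ y i) = w (y (g i)) := fun i => rfl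
  simp only [h]
  rw [← Finset.prod_fiberwise Finset.univ g]
  refine Finset.prod_congr rfl fun A _ => ?_
  have e : (Finset.univ.filter fun i => g i = A) = A.1 := by
    ext i
    simp only [Finset.mem_filter, Finset.mem_univ, true_and, g, Subtype.ext_iff]
    exact σ.part_eq_iff_mem A.2
  rw [Finset.prod_congr rfl (g := fun _ => w (y A)) fun i hi => by
    rw [(Finset.mem_filter.1 hi).2], Finset.prod_const, e]

variable {E : Type*} [MeasurableSpace E]

instance (α : Measure E) [IsFiniteMeasure α] (n : ℕ) : IsFiniteMeasure (lambdaMeasure α n) := by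
  refine ⟨?_⟩
  rw [lambdaMeasure_apply α n MeasurableSet.univ]
  refine ENNReal.sum_lt_top.2 fun σ _ => ENNReal.mul_lt_top (ENNReal.natCast_lt_top _) ?_
  simp

theorem IsBddMeas.integrable {n : ℕ} {f : (Fin n → E) → ℝ} (hf : IsBddMeas f)
    (μ : Measure (Fin n → E)) [IsFiniteMeasure μ] : Integrable f μ := by
  obtain ⟨hm, C, hC⟩ := hf
  exact Integrable.of_bound hm.aestronglyMeasurable C (Filter.Eventually.of_forall hC)

theorem integral_lambdaMeasure (α : Measure E) [IsFiniteMeasure α] {n : ℕ}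
    {f : (Fin n → E) → ℝ} (hf : IsBddMeas f) :
    ∫ x, f x ∂(lambdaMeasure α n) = ∑ σ : Finpartition (Finset.univ : Finset (Fin n)),
      ((∏ A ∈ σ.parts, (A.card - 1)! : ℕ) : ℝ) *
        ∫ y, f (diagonalMap σ y) ∂(Measure.pi (fun _ : σ.parts => α)) := by
  rw [lambdaMeasure, integral_finsetSum_measure]
  · refine Finset.sum_congr rfl fun σ _ => ?_
    rw [integral_smul_measure, integral_map (measurable_diagonalMap σ).aemeasurable
      hf.1.aestronglyMeasurable]
    simp
  · intro σ _
    have : IsFiniteMeasure ((Measure.pi (fun _ : σ.parts => α)).map (diagonalMap σ)) :=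
      inferInstance
    exact (hf.integrable _).smul_measure (ENNReal.natCast_ne_top _)

theorem isBddMeas_prod {n : ℕ} {w : E → ℝ} (hw : Measurable w) {K : ℝ} (hK : ∀ x, |w x| ≤ K) :
    IsBddMeas fun x : Fin n → E => ∏ i, w (x i) :=
  ⟨Finset.measurable_prod _ fun i _ => hw.comp (measurable_pi_apply i), K ^ n, fun x => by
    rw [Finset.abs_prod]
    refine (Finset.prod_le_prod (fun i _ => abs_nonneg _) fun i _ => hK (x i)).trans_eq ?_
    simp⟩

/-- On a diagonal the tensor power becomes a product over blocks of ∫ w^|A| dα, so the exponential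
formula applies. -/
theorem integral_prod_lambdaMeasure (α : Measure E) [IsFiniteMeasure α] (n : ℕ) {w : E → ℝ}
    (hw : Measurable w) {K : ℝ} (hK : ∀ x, |w x| ≤ K) :
    ∫ x, ∏ i, w (x i) ∂(lambdaMeasure α n) =
      (n ! : ℝ) * expCoeff (fun k => ∫ x, w x ^ (k + 1) ∂α) n := by
  rw [integral_lambdaMeasure α (isBddMeas_prod hw hK),
    ← sum_finpartition_eq_expCoeff _ n (Finset.univ : Finset (Fin n)) (by simp)]
  refine Finset.sum_congr rfl fun σ _ => ?_
  simp only [prod_diagonalMap]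
  rw [integral_fintype_prod_eq_prod (fun (A : σ.parts) x => w x ^ A.1.card), Finset.prod_mul_distrib]
  push_cast
  congr 1
  rw [Finset.prod_coe_sort σ.parts fun A => ∫ x, w x ^ A.card ∂α]
  refine Finset.prod_congr rfl fun A hA => ?_
  rw [Nat.sub_add_cancel (Finset.card_pos.2 (σ.nonempty_of_mem_parts hA))]

end

/-! ### Polarization and monotone classes. -/

section

/-- Ryser's formula for the permanent, with the roles of rows and columns exchanged. -/
theorem sum_neg_one_pow_mul_prod_sum {n : ℕ} (y : Fin n → Fin n → ℝ) :
    ∑ K : Finset (Fin n), (-1 : ℝ) ^ K.card * ∏ k, ∑ i ∈ Kᶜ, y k i =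
      ∑ π : Equiv.Perm (Fin n), ∏ i, y (π i) i := by
  have h1 : ∀ K : Finset (Fin n), (-1 : ℝ) ^ K.card * ∏ k, ∑ i ∈ Kᶜ, y k i =
      ∑ s : Fin n → Fin n, (if K ⊆ (Finset.univ.image s)ᶜ then (-1 : ℝ) ^ K.card else 0) *
        ∏ k, y k (s k) := fun K => by
    rw [Finset.prod_univ_sum, Finset.mul_sum]
    simp only [ite_mul, zero_mul]
    rw [← Finset.sum_filter]
    refine Finset.sum_congr ?_ fun _ _ => rfl
    ext s
    simp only [Fintype.mem_piFinset, Finset.mem_compl, Finset.mem_filter, Finset.mem_univ,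
      true_and, Finset.subset_iff, Finset.mem_image, not_exists]
    exact ⟨fun h x hx a ha => h a (ha ▸ hx), fun h a ha => h ha a rfl⟩
  -- Inclusion-exclusion: the alternating sum over subsets of the values missed by s vanishes unless
  -- s is onto.
  have h2 : ∀ s : Fin n → Fin n,
      ∑ K : Finset (Fin n), (if K ⊆ (Finset.univ.image s)ᶜ then (-1 : ℝ) ^ K.card else 0) =
        if Function.Bijective s then 1 else 0 := fun s => by
    rw [← Finset.sum_filter]
    have e : (Finset.univ.filter fun K => K ⊆ (Finset.univ.image s)ᶜ) =
        (Finset.univ.image s)ᶜ.powerset := by ext K; simp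
    have h3 := congrArg (Int.cast : ℤ → ℝ)
      (Finset.sum_powerset_neg_one_pow_card (x := (Finset.univ.image s)ᶜ))
    push_cast at h3
    rw [e, h3]
    congr 1
    rw [Finset.compl_eq_empty_iff, ← Finite.surjective_iff_bijective]
    simp [Finset.eq_univ_iff_forall, Function.Surjective]
  simp only [h1]
  rw [Finset.sum_comm]
  simp only [← Finset.sum_mul, h2]
  simp only [ite_mul, one_mul, zero_mul]
  rw [← Finset.sum_filter]
  refine (Finset.sum_bij (fun (π : Equiv.Perm (Fin n)) _ => ⇑π.symm) ?_ ?_ ?_ ?_).symm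
  · exact fun π _ => Finset.mem_filter.2 ⟨Finset.mem_univ _, π.symm.bijective⟩
  · intro π _ τ _ h
    exact Equiv.symm_bijective.injective (DFunLike.coe_injective h)
  · intro s hs
    exact ⟨(Equiv.ofBijective s (Finset.mem_filter.1 hs).2).symm, Finset.mem_univ _, rfl⟩
  · intro π _
    rw [← Equiv.prod_comp π fun k => y k (π.symm k)]
    simp

variable {E : Type*} [MeasurableSpace E] {n : ℕ}

namespace IsBddMeas

variable {f g : (Fin n → E) → ℝ}

theorem add (hf : IsBddMeas f) (hg : IsBddMeas g) : IsBddMeas fun x => f x + g x := by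
  obtain ⟨hf, C, hC⟩ := hf
  obtain ⟨hg, D, hD⟩ := hg
  exact ⟨hf.add hg, C + D, fun x => (abs_add_le _ _).trans (add_le_add (hC x) (hD x))⟩

theorem const (c : ℝ) : IsBddMeas fun _ : Fin n → E => c := ⟨measurable_const, |c|, fun _ => le_rfl⟩

theorem mul (hf : IsBddMeas f) (hg : IsBddMeas g) : IsBddMeas fun x => f x * g x := by
  obtain ⟨hf, C, hC⟩ := hf
  obtain ⟨hg, D, hD⟩ := hg
  refine ⟨hf.mul hg, C * D, fun x => ?_⟩
  rw [abs_mul]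
  exact mul_le_mul (hC x) (hD x) (abs_nonneg _) ((abs_nonneg _).trans (hC x))

theorem const_mul (c : ℝ) (hf : IsBddMeas f) : IsBddMeas fun x => c * f x := (const c).mul hf

theorem sum {ι : Type*} (s : Finset ι) {F : ι → (Fin n → E) → ℝ}
    (h : ∀ i ∈ s, IsBddMeas (F i)) : IsBddMeas fun x => ∑ i ∈ s, F i x := by
  classical
  induction s using Finset.induction_on with
  | empty => simpa using const 0
  | insert a s ha ih =>
    simp only [Finset.sum_insert ha]
    exact (h a (Finset.mem_insert_self _ _)).add (ih fun i hi => h i (Finset.mem_insert_of_mem hi))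

theorem comp_perm (hf : IsBddMeas f) (π : Equiv.Perm (Fin n)) :
    IsBddMeas fun x : Fin n → E => f fun i => x (π i) := by
  obtain ⟨hf, C, hC⟩ := hf
  exact ⟨hf.comp (measurable_pi_lambda _ fun i => measurable_pi_apply _), C, fun x => hC _⟩

end IsBddMeas

/-- The sum of a function over all permutations of its arguments. -/
def permSum (f : (Fin n → E) → ℝ) (x : Fin n → E) : ℝ :=
  ∑ π : Equiv.Perm (Fin n), f fun i => x (π i)

theorem IsBddMeas.permSum {f : (Fin n → E) → ℝ} (hf : IsBddMeas f) : IsBddMeas (permSum f) :=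
  IsBddMeas.sum _ fun π _ => hf.comp_perm π

theorem IsSymmBddMeas.permSum_eq {f : (Fin n → E) → ℝ} (hf : IsSymmBddMeas f) (x : Fin n → E) :
    permSum f x = (n ! : ℝ) * f x := by
  simp [permSum, hf.2, Fintype.card_perm]

/-- Properties of functions on `E ^ n` that are stable under linear combinations and bounded
pointwise limits. -/
structure IsBddClosed (P : ((Fin n → E) → ℝ) → Prop) : Prop where
  add : ∀ f g, IsBddMeas f → IsBddMeas g → P f → P g → P fun x => f x + g x
  const_mul : ∀ (c : ℝ) (f), IsBddMeas f → P f → P fun x => c * f x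
  lim : ∀ (F : ℕ → (Fin n → E) → ℝ) (f) (C : ℝ), (∀ k, Measurable (F k)) →
    (∀ k x, |F k x| ≤ C) → (∀ x, Filter.Tendsto (F · x) Filter.atTop (nhds (f x))) →
    (∀ k, P (F k)) → P f

theorem isBddMeas_indicator {S : Set (Fin n → E)} (hS : MeasurableSet S) :
    IsBddMeas (S.indicator fun _ => (1 : ℝ)) :=
  ⟨measurable_const.indicator hS, 1, fun x => by
    by_cases hx : x ∈ S <;> simp [hx]⟩

theorem IsBddClosed.sum {P : ((Fin n → E) → ℝ) → Prop} (hP : IsBddClosed P) {ι : Type*}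
    {s : Finset ι} (hs : s.Nonempty) {F : ι → (Fin n → E) → ℝ} (h : ∀ i ∈ s, IsBddMeas (F i))
    (h' : ∀ i ∈ s, P (F i)) : P fun x => ∑ i ∈ s, F i x := by
  classical
  induction hs using Finset.Nonempty.cons_induction with
  | singleton a => simpa using h' a (by simp)
  | cons a s ha hs ih =>
    simp only [Finset.sum_cons]
    exact hP.add _ _ (h a (by simp))
      (IsBddMeas.sum _ fun i hi => h i (Finset.mem_cons_of_mem hi)) (h' a (by simp))
      (ih (fun i hi => h i (Finset.mem_cons_of_mem hi))
        fun i hi => h' i (Finset.mem_cons_of_mem hi))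

/-- Dynkin's π-λ argument, starting from rectangles. -/
theorem IsBddClosed.indicator {P : ((Fin n → E) → ℝ) → Prop} (hP : IsBddClosed P)
    (hrect : ∀ A : Fin n → Set E, (∀ i, MeasurableSet (A i)) →
      P ((Set.univ.pi A).indicator fun _ => 1)) {S : Set (Fin n → E)} (hS : MeasurableSet S) :
    P (S.indicator fun _ => 1) := by
  have huniv : P fun _ => 1 := by
    have := hrect (fun _ => Set.univ) fun _ => MeasurableSet.univ
    simpa using this
  have hempty : P ((∅ : Set (Fin n → E)).indicator fun _ => 1) := by
    have := hP.const_mul 0 _ (IsBddMeas.const 1) huniv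
    simpa using this
  refine MeasurableSpace.induction_on_inter (C := fun S _ => P (S.indicator fun _ => 1))
    generateFrom_pi.symm isPiSystem_pi hempty ?_ ?_ ?_ S hS
  · rintro S ⟨A, hA, rfl⟩
    exact hrect A fun i => hA i (Set.mem_univ i)
  · intro S hS ih
    have := hP.add _ _ (IsBddMeas.const 1) ((isBddMeas_indicator hS).const_mul (-1)) huniv
      (hP.const_mul (-1) _ (isBddMeas_indicator hS) ih)
    convert this using 2 with x
    by_cases hx : x ∈ S <;> simp [hx]
  · intro B hd hB ih
    have hmeas : ∀ k, MeasurableSet (⋃ i ∈ Finset.range k, B i) := fun k =>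
      Finset.measurableSet_biUnion _ fun i _ => hB i
    have hk : ∀ k, P ((⋃ i ∈ Finset.range k, B i).indicator fun _ => 1) := fun k => by
      induction k with
      | zero => simpa using hempty
      | succ k ihk =>
        rw [Finset.range_add_one, Finset.set_biUnion_insert, Set.indicator_union_of_disjoint]
        · exact hP.add _ _ (isBddMeas_indicator (hB k)) (isBddMeas_indicator (hmeas k)) (ih k) ihk
        · rw [Set.disjoint_iUnion₂_right]
          exact fun i hi => hd (Finset.mem_range.1 hi).ne'
    have hU : ⋃ i, B i = ⋃ k, ⋃ i ∈ Finset.range k, B i := by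
      ext x
      simp only [Set.mem_iUnion, Finset.mem_range, exists_prop]
      exact ⟨fun ⟨i, hi⟩ => ⟨i + 1, i, Nat.lt_succ_self i, hi⟩, fun ⟨k, i, _, hi⟩ => ⟨i, hi⟩⟩
    refine hP.lim (fun k => (⋃ i ∈ Finset.range k, B i).indicator fun _ => 1) _ 1
      (fun k => (isBddMeas_indicator (hmeas k)).1) (fun k x => ?_) (fun x => ?_) hk
    · by_cases hx : x ∈ ⋃ i ∈ Finset.range k, B i <;> simp only [Set.indicator, hx] <;> simp
    · rw [hU]
      refine (Monotone.tendsto_indicator _ ?_ _ x).mono_right (pure_le_nhds _)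
      intro k l hkl
      exact Set.biUnion_subset_biUnion_left fun i hi => by
        simp only [Finset.coe_range, Finset.mem_range, Set.mem_Iio] at *
        exact lt_of_lt_of_le hi hkl

/-- A functional monotone class theorem for bounded functions on `E ^ n`. -/
theorem IsBddClosed.of_rect {P : ((Fin n → E) → ℝ) → Prop} (hP : IsBddClosed P)
    (hrect : ∀ A : Fin n → Set E, (∀ i, MeasurableSet (A i)) →
      P ((Set.univ.pi A).indicator fun _ => 1)) {f : (Fin n → E) → ℝ} (hf : IsBddMeas f) :
    P f := by
  have hsimple : ∀ g : SimpleFunc (Fin n → E) ℝ, P g := fun g => by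
    have hb : ∀ g : SimpleFunc (Fin n → E) ℝ, IsBddMeas g := fun g => by
      obtain ⟨C, hC⟩ := g.exists_forall_norm_le
      exact ⟨g.measurable, C, hC⟩
    induction g using SimpleFunc.induction with
    | const c hS =>
      have := hP.const_mul c _ (isBddMeas_indicator hS) (hP.indicator hrect hS)
      convert this using 1
      ext x
      rename_i S
      by_cases hx : x ∈ S <;> simp [hx]
    | @add f g' _ hf hg => exact hP.add f g' (hb f) (hb g') hf hg
  obtain ⟨hm, C, hC⟩ := hf
  have hC' : ∀ x, |f x| ≤ |C| := fun x => (hC x).trans (le_abs_self C)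
  refine hP.lim (fun k => hm.stronglyMeasurable.approxBounded |C| k) f |C|
    (fun k => (hm.stronglyMeasurable.approxBounded |C| k).measurable) (fun k x => ?_)
    (fun x => ?_) fun k => hsimple _
  · exact hm.stronglyMeasurable.norm_approxBounded_le (abs_nonneg C) k x
  · exact hm.stronglyMeasurable.tendsto_approxBounded_of_norm_le (hC' x)

/-- Symmetrized bounded functions are limits of linear combinations of tensor powers. -/
theorem IsBddClosed.of_pow {P : ((Fin n → E) → ℝ) → Prop} (hP : IsBddClosed P)
    (hpow : ∀ w : E → ℝ, Measurable w → (Set.range w).Finite → P fun x => ∏ i, w (x i))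
    {f : (Fin n → E) → ℝ} (hf : IsBddMeas f) : P (permSum f) := by
  -- Symmetrization is linear and preserves bounded limits, so rectangles suffice.
  have hclosed : IsBddClosed fun f : (Fin n → E) → ℝ => P (permSum f) := by
    refine ⟨fun f g hf hg h1 h2 => ?_, fun c f hf h => ?_, fun F f C hF hC hlim h => ?_⟩
    · convert! hP.add _ _ hf.permSum hg.permSum h1 h2 using 2 with x
      exact Finset.sum_add_distrib
    · convert! hP.const_mul c _ hf.permSum h using 2 with x
      exact (Finset.mul_sum _ _ _).symm
    · refine hP.lim (fun k => permSum (F k)) _ ((n ! : ℝ) * C)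
        (fun k => (IsBddMeas.permSum ⟨hF k, C, hC k⟩).1) (fun k x => ?_)
        (fun x => tendsto_finsetSum _ fun π _ => hlim _) h
      refine (Finset.abs_sum_le_sum_abs _ _).trans ((Finset.sum_le_sum fun π _ => hC k _).trans ?_)
      simp [Fintype.card_perm]
  refine hclosed.of_rect (fun A hA => ?_) hf
  have hind : ∀ i, Measurable ((A i).indicator fun _ => (1 : ℝ)) := fun i =>
    measurable_const.indicator (hA i)
  let w : Finset (Fin n) → E → ℝ := fun K z => ∑ i ∈ Kᶜ, (A i).indicator (fun _ => 1) z
  have hw : ∀ K, Measurable (w K) := fun K => Finset.measurable_sum _ fun i _ => hind i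
  have hwr : ∀ K, (Set.range (w K)).Finite := fun K => by
    -- The value at z depends only on which of the finitely many sets contain z.
    refine (Set.finite_range fun J : Finset (Fin n) => ∑ i ∈ Kᶜ, if i ∈ J then (1 : ℝ) else 0).subset
      ?_
    classical
    rintro _ ⟨z, rfl⟩
    refine ⟨Finset.univ.filter fun i => z ∈ A i, Finset.sum_congr rfl fun i _ => ?_⟩
    simp [Set.indicator_apply]
  have hwb : ∀ K, IsBddMeas fun x : Fin n → E => ∏ i, w K (x i) := fun K => by
    obtain ⟨C, hC⟩ := ((hwr K).image fun r => |r|).bddAbove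
    exact isBddMeas_prod (hw K) (K := C) fun z => hC ⟨_, ⟨z, rfl⟩, rfl⟩
  -- The symmetrized rectangle is a permanent, hence by Ryser a signed sum of tensor powers.
  have e : permSum ((Set.univ.pi A).indicator fun _ => (1 : ℝ)) =
      fun x => ∑ K : Finset (Fin n), (-1 : ℝ) ^ K.card * ∏ k, w K (x k) := by
    ext x
    rw [sum_neg_one_pow_mul_prod_sum fun k i => (A i).indicator (fun _ => (1 : ℝ)) (x k)]
    refine Finset.sum_congr rfl fun π _ => ?_
    by_cases h : ∀ i, x (π i) ∈ A i
    · rw [Set.indicator_of_mem (by simpa using h)]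
      exact (Finset.prod_eq_one fun i _ => Set.indicator_of_mem (h i) _).symm
    · rw [Set.indicator_of_notMem (by simpa using h)]
      obtain ⟨i, hi⟩ := not_forall.1 h
      exact (Finset.prod_eq_zero (Finset.mem_univ i) (Set.indicator_of_notMem hi _)).symm
  rw [e]
  exact hP.sum Finset.univ_nonempty (fun K _ => (hwb K).const_mul _)
    fun K _ => hP.const_mul _ _ (hwb K) (hpow _ (hw K) (hwr K))

theorem IsBddClosed.of_pow_of_symm {P : ((Fin n → E) → ℝ) → Prop} (hP : IsBddClosed P)
    (hpow : ∀ w : E → ℝ, Measurable w → (Set.range w).Finite → P fun x => ∏ i, w (x i))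
    {f : (Fin n → E) → ℝ} (hf : IsSymmBddMeas f) : P f := by
  have := hP.const_mul (n ! : ℝ)⁻¹ _ hf.1.permSum (hP.of_pow hpow hf.1)
  convert this using 2 with x
  have : (n ! : ℝ) ≠ 0 := by positivity
  rw [hf.permSum_eq, inv_mul_cancel_left₀ this]

end

/-! ### Polynomials in the process, as functions and in L². -/

section

theorem exists_bound_of_finite_range {E : Type*} {u : E → ℝ} (hu : (Set.range u).Finite) :
    ∃ K, ∀ x, |u x| ≤ K := by
  obtain ⟨C, hC⟩ := (hu.image fun r => |r|).bddAbove
  exact ⟨C, fun z => hC ⟨_, ⟨z, rfl⟩, rfl⟩⟩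

variable {E : Type*} [MeasurableSpace E]

theorem monomial_add {n : ℕ} {f g : (Fin n → E) → ℝ} (hf : IsBddMeas f) (hg : IsBddMeas g)
    (η : CountingMeasure E) :
    monomial n (fun x => f x + g x) η = monomial n f η + monomial n g η :=
  integral_add (hf.integrable _) (hg.integrable _)

theorem monomial_const_mul {n : ℕ} (c : ℝ) (f : (Fin n → E) → ℝ) (η : CountingMeasure E) :
    monomial n (fun x => c * f x) η = c * monomial n f η :=
  integral_const_mul _ _

theorem monomial_prod (n : ℕ) (w : E → ℝ) (η : CountingMeasure E) :
    monomial n (fun x => ∏ i, w (x i)) η = (∫ x, w x ∂η.1) ^ n := by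
  simpa [monomial] using integral_fintype_prod_eq_pow (ι := Fin n) (μ := η.1) w

theorem map_comp_perm {n : ℕ} (μ : Measure E) [IsFiniteMeasure μ] (π : Equiv.Perm (Fin n)) :
    (Measure.pi fun _ : Fin n => μ).map (fun x i => x (π i)) = Measure.pi fun _ => μ := by
  have hm : Measurable fun (x : Fin n → E) i => x (π i) :=
    measurable_pi_lambda _ fun i => measurable_pi_apply _
  refine (Measure.pi_eq fun s hs => ?_).symm
  rw [Measure.map_apply hm (MeasurableSet.univ_pi hs)]
  have : (fun (x : Fin n → E) i => x (π i)) ⁻¹' Set.univ.pi s =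
      Set.univ.pi fun i => s (π.symm i) := by
    ext x
    simp only [Set.mem_preimage, Set.mem_pi, Set.mem_univ, true_imp_iff]
    exact ⟨fun h i => by simpa using h (π.symm i), fun h i => by simpa using h (π i)⟩
  rw [this, Measure.pi_pi]
  exact Equiv.prod_comp π.symm fun i => μ (s i)

/-- Product measures are permutation invariant, so monomials only see the symmetrization; this lets
polarization treat arbitrary coefficients. -/
theorem monomial_permSum {n : ℕ} {f : (Fin n → E) → ℝ} (hf : IsBddMeas f)
    (η : CountingMeasure E) : monomial n (permSum f) η = (n ! : ℝ) * monomial n f η := by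
  unfold monomial permSum
  rw [integral_finsetSum _ fun π _ => (hf.comp_perm π).integrable _]
  rw [Finset.sum_congr rfl (g := fun _ => ∫ x, f x ∂(Measure.pi fun _ : Fin n => η.1))]
  · simp [Fintype.card_perm]
  · intro π _
    conv_rhs => rw [← map_comp_perm η.1 π]
    rw [integral_map]
    · exact (measurable_pi_lambda _ fun i => measurable_pi_apply _).aemeasurable
    · exact hf.1.aestronglyMeasurable

theorem monomial_mul_integral {n : ℕ} (f : (Fin n → E) → ℝ) (w : E → ℝ)
    (η : CountingMeasure E) : monomial n f η * ∫ x, w x ∂η.1 =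
      monomial (n + 1) (fun x => w (x 0) * f fun i => x i.succ) η := by
  have h := (measurePreserving_piFinSuccAbove (fun _ : Fin (n + 1) => η.1) 0).integral_comp
    (MeasurableEquiv.measurableEmbedding _) fun z => w z.1 * f z.2
  rw [integral_prod_mul] at h
  rw [mul_comm]
  exact h.symm

/-- Linear combinations of monomials of degree less than `n`, as functions. -/
def polyFun (E : Type*) [MeasurableSpace E] (n : ℕ) : Submodule ℝ (CountingMeasure E → ℝ) :=
  Submodule.span ℝ {F | ∃ k : ℕ, k < n ∧ ∃ f : (Fin k → E) → ℝ, IsBddMeas f ∧ F = monomial k f}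

theorem polyFun_mono {m n : ℕ} (h : m ≤ n) : polyFun E m ≤ polyFun E n :=
  Submodule.span_mono fun _ ⟨k, hk, hf⟩ => ⟨k, hk.trans_le h, hf⟩

theorem mul_integral_mem_polyFun {n : ℕ} {F : CountingMeasure E → ℝ} (hF : F ∈ polyFun E n)
    {w : E → ℝ} (hw : Measurable w) {K : ℝ} (hK : ∀ x, |w x| ≤ K) :
    (fun η => F η * ∫ x, w x ∂η.1) ∈ polyFun E (n + 1) := by
  induction hF using Submodule.span_induction with
  | mem F hF =>
    obtain ⟨k, hk, f, hf, rfl⟩ := hF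
    refine Submodule.subset_span ⟨k + 1, by omega, fun x => w (x 0) * f fun i => x i.succ, ?_,
      funext fun η => monomial_mul_integral f w η⟩
    obtain ⟨hfm, C, hC⟩ := hf
    exact IsBddMeas.mul ⟨hw.comp (measurable_pi_apply _), K, fun x => hK _⟩
      ⟨hfm.comp (measurable_pi_lambda _ fun i => measurable_pi_apply _), C, fun x => hC _⟩
  | zero =>
    convert! (polyFun E (n + 1)).zero_mem using 1
    ext η; simp
  | add F G _ _ h1 h2 =>
    convert! (polyFun E (n + 1)).add_mem h1 h2 using 1
    ext η; simp [add_mul]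
  | smul c F _ h =>
    convert! (polyFun E (n + 1)).smul_mem c h using 1
    ext η; simp [mul_assoc]

theorem pow_mem_polyFun {w : E → ℝ} (hw : Measurable w) {K : ℝ} (hK : ∀ x, |w x| ≤ K) (n : ℕ) :
    (fun η : CountingMeasure E => (∫ x, w x ∂η.1) ^ n) ∈ polyFun E (n + 1) :=
  Submodule.subset_span ⟨n, by omega, fun x => ∏ i, w (x i), isBddMeas_prod hw hK,
    funext fun η => (monomial_prod n w η).symm⟩

/-- The leading term of the polynomials `chaosPoly`. -/
theorem chaosPoly_sub_mem_polyFun (p : ℝ) (α : Measure E) {u : E → ℝ} (hu : Measurable u)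
    {K : ℝ} (hK : ∀ x, |u x| ≤ K) (n : ℕ) :
    (fun η => chaosPoly p α u n η - (p⁻¹ - 1) ^ n / (n ! : ℝ) * (∫ x, u x ∂η.1) ^ n) ∈
      polyFun E n := by
  induction n using Nat.strong_induction_on with
  | _ n ih =>
    have hmem : ∀ i < n, chaosPoly p α u i ∈ polyFun E (i + 1) := fun i hi => by
      have := (polyFun E (i + 1)).add_mem (polyFun_mono (Nat.le_succ i) (ih i hi))
        ((polyFun E (i + 1)).smul_mem ((p⁻¹ - 1) ^ i / (i ! : ℝ)) (pow_mem_polyFun hu hK i))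
      convert! this using 1
      ext η
      simp
    cases n with
    | zero =>
      convert! (polyFun E 0).zero_mem using 1
      ext η
      simp [chaosPoly]
    | succ n =>
      have hup : ∀ k, Measurable fun x => u x ^ (k + 1) := fun k => hu.pow_const _
      have hKp : ∀ k x, |u x ^ (k + 1)| ≤ K ^ (k + 1) := fun k x => by
        rw [abs_pow]; exact pow_le_pow_left₀ (abs_nonneg _) (hK x) _
      -- Terms i < n of the recursion have degree at most i + 1 ≤ n. Only i = n reaches degree n +
      -- 1, through (1/p - 1) ∫ u dη.
      have hlow : (fun η => ∑ i ∈ Finset.range n, ((-1) ^ (n - i) *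
          (p⁻¹ ^ (n - i + 1) * ∫ x, u x ^ (n - i + 1) ∂η.1 -
          (∫ x, u x ^ (n - i + 1) ∂α + ∫ x, u x ^ (n - i + 1) ∂η.1))) *
          chaosPoly p α u i η) ∈ polyFun E (n + 1) := by
        have : (fun η => ∑ i ∈ Finset.range n, ((-1) ^ (n - i) *
          (p⁻¹ ^ (n - i + 1) * ∫ x, u x ^ (n - i + 1) ∂η.1 -
          (∫ x, u x ^ (n - i + 1) ∂α + ∫ x, u x ^ (n - i + 1) ∂η.1))) *
          chaosPoly p α u i η) = ∑ i ∈ Finset.range n,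
            (((-1) ^ (n - i) * (p⁻¹ ^ (n - i + 1) - 1)) •
              (fun η => chaosPoly p α u i η * ∫ x, u x ^ (n - i + 1) ∂η.1) +
            ((-1) ^ (n - i) * (-∫ x, u x ^ (n - i + 1) ∂α)) • chaosPoly p α u i) := by
          ext η
          rw [Finset.sum_apply]
          refine Finset.sum_congr rfl fun i _ => ?_
          simp only [Pi.add_apply, Pi.smul_apply, smul_eq_mul]
          ring
        rw [this]
        refine Submodule.sum_mem _ fun i hi => Submodule.add_mem _ (Submodule.smul_mem _ _ ?_)
          (Submodule.smul_mem _ _ ?_)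
        · have hi := Finset.mem_range.1 hi
          exact polyFun_mono (by omega)
            (mul_integral_mem_polyFun (hmem i (by omega)) (hup (n - i)) (hKp (n - i)))
        · have hi := Finset.mem_range.1 hi
          exact polyFun_mono (by omega) (hmem i (by omega))
      have h1 := mul_integral_mem_polyFun (ih n (Nat.lt_succ_self n)) hu hK
      have h2 := hmem n (Nat.lt_succ_self n)
      have h3 := (polyFun E (n + 1)).smul_mem ((n : ℝ) + 1)⁻¹
        ((polyFun E (n + 1)).add_mem hlow ((polyFun E (n + 1)).add_mem
          ((polyFun E (n + 1)).smul_mem (p⁻¹ - 1) h1)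
          ((polyFun E (n + 1)).smul_mem (-∫ x, u x ∂α) h2)))
      convert! h3 using 1
      ext η
      have h0 : (n : ℝ) + 1 ≠ 0 := by positivity
      have h0' : (n ! : ℝ) ≠ 0 := by positivity
      simp only [Pi.add_apply, Pi.smul_apply, smul_eq_mul]
      rw [chaosPoly, expCoeff_succ, Finset.sum_range_succ, Nat.factorial_succ]
      simp only [Nat.sub_self, pow_zero, zero_add, pow_one, one_mul]
      change (_ + _ * chaosPoly p α u n η) / _ - _ = _ * (_ + _)
      have e : ∀ i, expCoeff (fun k => (-1) ^ k * (p⁻¹ ^ (k + 1) * ∫ x, u x ^ (k + 1) ∂η.1 -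
          (∫ x, u x ^ (k + 1) ∂α + ∫ x, u x ^ (k + 1) ∂η.1))) i = chaosPoly p α u i η :=
        fun i => rfl
      simp only [e]
      push_cast
      field_simp
      ring

variable {p : ℝ} {α : Measure E} {ρ : Measure (CountingMeasure E)}

theorem isTame_of_mem_polyFun {n : ℕ} {F : CountingMeasure E → ℝ} (hF : F ∈ polyFun E n) :
    IsTame F := by
  induction hF using Submodule.span_induction with
  | mem F hF =>
    obtain ⟨k, _, f, hf, rfl⟩ := hF
    exact IsTame.monomial hf
  | zero => exact IsTame.const 0
  | add F G _ _ h1 h2 => exact h1.add h2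
  | smul c F _ h => exact h.const_mul c

theorem isTame_integral {w : E → ℝ} (hw : Measurable w) {K : ℝ} (hK : ∀ x, |w x| ≤ K) :
    IsTame fun η : CountingMeasure E => ∫ x, w x ∂η.1 := by
  have := isTame_of_mem_polyFun (pow_mem_polyFun hw hK 1)
  simpa using this

theorem isTame_chaosPoly (p : ℝ) (α : Measure E) {u : E → ℝ} (hu : Measurable u)
    {K : ℝ} (hK : ∀ x, |u x| ≤ K) (n : ℕ) : IsTame (chaosPoly p α u n) := by
  have := (isTame_of_mem_polyFun (chaosPoly_sub_mem_polyFun p α hu hK n)).add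
    (((isTame_integral hu hK).pow n).const_mul ((p⁻¹ - 1) ^ n / (n ! : ℝ)))
  simpa using this

theorem polynomialsBelow_eq (ρ : Measure (CountingMeasure E)) (n : ℕ) :
    polynomialsBelow ρ n = Submodule.span ℝ {F | ∃ k : ℕ, k < n ∧ ∃ f : (Fin k → E) → ℝ,
      IsBddMeas f ∧ F = monomialL2 ρ k f} := by
  cases n with
  | zero => simp [polynomialsBelow]
  | succ n => simp only [polynomialsBelow, polynomials, Nat.lt_succ_iff]

theorem polynomialsBelow_mono {m n : ℕ} (h : m ≤ n) :
    polynomialsBelow ρ m ≤ polynomialsBelow ρ n := by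
  rw [polynomialsBelow_eq, polynomialsBelow_eq]
  exact Submodule.span_mono fun _ ⟨k, hk, hf⟩ => ⟨k, hk.trans_le h, hf⟩

theorem IsPascal.memLp_monomial (hp0 : 0 < p) (hp1 : p < 1) (hρ : IsPascal p α ρ) {n : ℕ}
    {f : (Fin n → E) → ℝ} (hf : IsBddMeas f) : MemLp (monomial n f) 2 ρ :=
  (IsTame.monomial hf).memLp hp0 hp1 hρ

theorem IsPascal.monomialL2_eq (hp0 : 0 < p) (hp1 : p < 1) (hρ : IsPascal p α ρ) {n : ℕ}
    {f : (Fin n → E) → ℝ} (hf : IsBddMeas f) :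
    monomialL2 ρ n f = (hρ.memLp_monomial hp0 hp1 hf).toLp _ :=
  dif_pos _

theorem IsPascal.toLp_mem_polynomialsBelow (hp0 : 0 < p) (hp1 : p < 1) (hρ : IsPascal p α ρ)
    {n : ℕ} {F : CountingMeasure E → ℝ} (hF : F ∈ polyFun E n) :
    ((isTame_of_mem_polyFun hF).memLp hp0 hp1 hρ).toLp F ∈ polynomialsBelow ρ n := by
  -- Square integrability is carried through the induction because the L² class is formed from its
  -- proof.
  suffices ∃ h : MemLp F 2 ρ, h.toLp F ∈ polynomialsBelow ρ n from this.2
  induction hF using Submodule.span_induction with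
  | mem F hF =>
    obtain ⟨k, hk, f, hf, rfl⟩ := hF
    refine ⟨hρ.memLp_monomial hp0 hp1 hf, ?_⟩
    rw [polynomialsBelow_eq]
    exact Submodule.subset_span ⟨k, hk, f, hf, (hρ.monomialL2_eq hp0 hp1 hf).symm⟩
  | zero => exact ⟨MemLp.zero, by rw [MemLp.toLp_zero]; exact Submodule.zero_mem _⟩
  | add F G _ _ h1 h2 =>
    obtain ⟨h1, h1'⟩ := h1
    obtain ⟨h2, h2'⟩ := h2
    exact ⟨h1.add h2, by rw [MemLp.toLp_add h1 h2]; exact Submodule.add_mem _ h1' h2'⟩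
  | smul c F _ h =>
    obtain ⟨h, h'⟩ := h
    exact ⟨h.const_smul c, by rw [MemLp.toLp_const_smul c h]; exact Submodule.smul_mem _ _ h'⟩

theorem integral_mul_eq_inner (F G : Lp ℝ 2 ρ) : ∫ η, F η * G η ∂ρ = inner ℝ F G := by
  rw [L2.inner_def]
  exact integral_congr_ae (Filter.Eventually.of_forall fun η => by simp [mul_comm])

theorem IsPascal.inner_monomialL2 (hp0 : 0 < p) (hp1 : p < 1) (hρ : IsPascal p α ρ) {n : ℕ}
    {f : (Fin n → E) → ℝ} (hf : IsBddMeas f) (G : Lp ℝ 2 ρ) :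
    inner ℝ (monomialL2 ρ n f) G = ∫ η, monomial n f η * G η ∂ρ := by
  rw [← integral_mul_eq_inner, hρ.monomialL2_eq hp0 hp1 hf]
  refine integral_congr_ae ?_
  filter_upwards [(hρ.memLp_monomial hp0 hp1 hf).coeFn_toLp] with η hη
  rw [hη]

theorem IsPascal.integrable_monomial_mul (hp0 : 0 < p) (hp1 : p < 1) (hρ : IsPascal p α ρ) {n : ℕ}
    {f : (Fin n → E) → ℝ} (hf : IsBddMeas f) (G : Lp ℝ 2 ρ) :
    Integrable (fun η => monomial n f η * G η) ρ :=
  (hρ.memLp_monomial hp0 hp1 hf).integrable_mul (Lp.memLp G)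

/-- Identities `⟨η^{⊗ n}(f), G⟩ = ∫ f h dν` are stable under linear combinations and bounded
pointwise limits of `f`. -/
theorem IsPascal.isBddClosed_inner_monomialL2 (hp0 : 0 < p) (hp1 : p < 1) (hρ : IsPascal p α ρ)
    {n : ℕ} (G : Lp ℝ 2 ρ) {h : (Fin n → E) → ℝ} (hh : IsBddMeas h) (ν : Measure (Fin n → E))
    [IsFiniteMeasure ν] :
    IsBddClosed fun f : (Fin n → E) → ℝ =>
      ∫ η, monomial n f η * G η ∂ρ = ∫ x, f x * h x ∂ν := by
  refine ⟨fun f g hf hg h1 h2 => ?_, fun c f hf h1 => ?_, fun F f C hF hC hlim h1 => ?_⟩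
  · simp only [monomial_add hf hg, add_mul]
    rw [integral_add (hρ.integrable_monomial_mul hp0 hp1 hf G)
      (hρ.integrable_monomial_mul hp0 hp1 hg G), h1, h2,
      integral_add ((hf.mul hh).integrable ν) ((hg.mul hh).integrable ν)]
  · simp only [monomial_const_mul, mul_assoc]
    rw [integral_const_mul, h1, integral_const_mul]
  · obtain ⟨hhm, D, hD⟩ := hh
    -- The monomial with constant coefficient C dominates all approximants.
    have hconst := (hρ.integrable_monomial_mul hp0 hp1 (IsBddMeas.const (E := E) (n := n) C) G).norm
    refine tendsto_nhds_unique (f := fun k => ∫ η, monomial n (F k) η * G η ∂ρ)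
      (l := Filter.atTop) ?_ ?_
    · refine tendsto_integral_of_dominated_convergence _ (fun k => ?_) hconst (fun k => ?_) ?_
      · exact (measurable_monomial (hF k)).aestronglyMeasurable.mul (Lp.aestronglyMeasurable G)
      · refine Filter.Eventually.of_forall fun η => ?_
        rw [norm_mul, norm_mul]
        refine mul_le_mul_of_nonneg_right ?_ (norm_nonneg _)
        refine (norm_integral_le_integral_norm _).trans ((integral_mono ?_ ?_ (hC k)).trans
          (le_abs_self _))
        · exact (IsBddMeas.integrable ⟨hF k, C, hC k⟩ _).norm
        · exact integrable_const _
      · refine Filter.Eventually.of_forall fun η => Filter.Tendsto.mul_const _ ?_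
        exact tendsto_integral_of_dominated_convergence (fun _ => C)
          (fun k => (hF k).aestronglyMeasurable) (integrable_const _)
          (fun k => Filter.Eventually.of_forall (hC k)) (Filter.Eventually.of_forall hlim)
    · simp only [h1]
      refine tendsto_integral_of_dominated_convergence (fun _ => C * D)
        (fun k => ((hF k).mul hhm).aestronglyMeasurable) (integrable_const _)
        (fun k => Filter.Eventually.of_forall fun x => ?_)
        (Filter.Eventually.of_forall fun x => (hlim x).mul_const _)
      rw [norm_mul]
      exact mul_le_mul (hC k x) (hD x) (norm_nonneg _) ((abs_nonneg _).trans (hC k x))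

end

/-! ### Identification of the orthogonal polynomials and their inner products. -/

section

variable {E : Type*} [MeasurableSpace E] {p : ℝ} {α : Measure E}
  {ρ : Measure (CountingMeasure E)}

theorem orthPoly_eq {n : ℕ} {f : (Fin n → E) → ℝ} {Q : Lp ℝ 2 ρ}
    (hQ : Q ∈ (polynomialsBelow ρ n)ᗮ) (hQ' : Q - monomialL2 ρ n f ∈ polynomialsBelow ρ n) :
    orthPoly ρ n f = Q := by
  rw [← Submodule.orthogonal_closure] at hQ
  refine Submodule.eq_starProjection_of_mem_orthogonal' (z := monomialL2 ρ n f - Q) hQ ?_ (by simp)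
  refine Submodule.le_orthogonal_orthogonal _ (Submodule.le_topologicalClosure _ ?_)
  simpa using neg_mem hQ'

theorem orthPoly_mem_orthogonal (ρ : Measure (CountingMeasure E)) (n : ℕ)
    (f : (Fin n → E) → ℝ) : orthPoly ρ n f ∈ ((polynomialsBelow ρ n).topologicalClosure)ᗮ :=
  Submodule.starProjection_apply_mem _ _

theorem orthPoly_mem_topologicalClosure {n m : ℕ} (h : n < m) {f : (Fin n → E) → ℝ}
    (hf : IsBddMeas f) : orthPoly ρ n f ∈ (polynomialsBelow ρ m).topologicalClosure := by
  rw [orthPoly, Submodule.starProjection_orthogonal_val]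
  refine sub_mem (Submodule.le_topologicalClosure _ ?_)
    (Submodule.topologicalClosure_mono (polynomialsBelow_mono h.le)
      (Submodule.starProjection_apply_mem _ _))
  rw [polynomialsBelow_eq]
  exact Submodule.subset_span ⟨n, h, f, hf, rfl⟩

theorem integral_orthPoly_mul_eq_zero {n m : ℕ} (h : n < m) {f : (Fin n → E) → ℝ}
    (hf : IsBddMeas f) (g : (Fin m → E) → ℝ) :
    ∫ η, orthPoly ρ n f η * orthPoly ρ m g η ∂ρ = 0 := by
  rw [integral_mul_eq_inner]
  exact (Submodule.mem_orthogonal _ _).1 (orthPoly_mem_orthogonal ρ m g) _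
    (orthPoly_mem_topologicalClosure h hf)

/-- The projection is self-adjoint and idempotent. The remaining monomial is an explicit integral in
f, to which the monotone class argument applies. -/
theorem IsPascal.integral_orthPoly_mul_orthPoly (hp0 : 0 < p) (hp1 : p < 1)
    (hρ : IsPascal p α ρ) {n : ℕ} {f g : (Fin n → E) → ℝ} (hf : IsBddMeas f) :
    ∫ η, orthPoly ρ n f η * orthPoly ρ n g η ∂ρ =
      ∫ η, monomial n f η * orthPoly ρ n g η ∂ρ := by
  rw [integral_mul_eq_inner, ← hρ.inner_monomialL2 hp0 hp1 hf, orthPoly, orthPoly,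
    Submodule.inner_starProjection_left_eq_right,
    Submodule.starProjection_eq_self_iff.2 (Submodule.starProjection_apply_mem _ _)]

theorem IsPascal.toLp_chaosPoly_mem_orthogonal [IsFiniteMeasure α] (hp0 : 0 < p) (hp1 : p < 1)
    (hρ : IsPascal p α ρ) {u : E → ℝ} (hu : Measurable u) (hu' : (Set.range u).Finite) {n : ℕ}
    (h : MemLp (chaosPoly p α u n) 2 ρ) : h.toLp _ ∈ (polynomialsBelow ρ n)ᗮ := by
  rw [polynomialsBelow_eq, Submodule.mem_orthogonal]
  intro F hF
  induction hF using Submodule.span_induction with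
  | mem F hF =>
    obtain ⟨k, hk, f, hf, rfl⟩ := hF
    rw [hρ.inner_monomialL2 hp0 hp1 hf]
    -- With h = 0 and ν = 0 the closed property reads "the pairing vanishes", which need only be
    -- tested on tensor powers.
    have h1 := (hρ.isBddClosed_inner_monomialL2 hp0 hp1 (h.toLp _) (IsBddMeas.const (E := E)
      (n := k) 0) 0).of_pow (fun v hv hv' => ?_) hf
    · simp only [monomial_permSum hf, mul_assoc] at h1
      rw [integral_const_mul] at h1
      simpa [Nat.factorial_ne_zero] using h1
    · simp only [mul_zero, integral_zero]
      rw [← hρ.integral_chaosPoly_mul_pow_of_lt hp0 hp1 hu hv hu' hv' hk]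
      refine integral_congr_ae ?_
      filter_upwards [h.coeFn_toLp] with η hη
      rw [hη, monomial_prod, mul_comm]
  | zero => simp
  | add F G _ _ h1 h2 => rw [inner_add_left, h1, h2, add_zero]
  | smul c F _ h1 => rw [inner_smul_left, h1, mul_zero]

/-- The orthogonal polynomial of a tensor power. -/
theorem IsPascal.orthPoly_prod_ae_eq [IsFiniteMeasure α] (hp0 : 0 < p) (hp1 : p < 1)
    (hρ : IsPascal p α ρ) {u : E → ℝ} (hu : Measurable u) (hu' : (Set.range u).Finite) (n : ℕ) :
    orthPoly ρ n (fun x => ∏ i, u (x i)) =ᵐ[ρ]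
      fun η => (n ! : ℝ) * (p / (1 - p)) ^ n * chaosPoly p α u n η := by
  obtain ⟨K, hK⟩ := exists_bound_of_finite_range hu'
  have hq := (isTame_chaosPoly p α hu hK n).memLp hp0 hp1 hρ
  have hb : IsBddMeas fun x : Fin n → E => ∏ i, u (x i) := isBddMeas_prod hu hK
  have hmem : (fun η => (n ! : ℝ) * (p / (1 - p)) ^ n * chaosPoly p α u n η) -
      monomial n (fun x => ∏ i, u (x i)) ∈ polyFun E n := by
    convert! (polyFun E n).smul_mem ((n ! : ℝ) * (p / (1 - p)) ^ n)
      (chaosPoly_sub_mem_polyFun p α hu hK n) using 1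
    ext η
    have h0 : (n ! : ℝ) ≠ 0 := by positivity
    have h1 : (1 - p) ≠ 0 := by linarith
    -- The normalizing factor is the inverse of the leading coefficient.
    have h2 : (p / (1 - p)) ^ n * (p⁻¹ - 1) ^ n = 1 := by
      rw [← mul_pow]
      have : p / (1 - p) * (p⁻¹ - 1) = 1 := by field_simp
      rw [this, one_pow]
    simp only [Pi.sub_apply, Pi.smul_apply, smul_eq_mul, monomial_prod]
    rw [mul_sub]
    congr 1
    calc (∫ x, u x ∂η.1) ^ n = ((p / (1 - p)) ^ n * (p⁻¹ - 1) ^ n) * (∫ x, u x ∂η.1) ^ n := by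
          rw [h2, one_mul]
      _ = _ := by field_simp
  have hκ := hq.const_mul ((n ! : ℝ) * (p / (1 - p)) ^ n)
  have e : orthPoly ρ n (fun x => ∏ i, u (x i)) = hκ.toLp _ := by
    refine orthPoly_eq ?_ ?_
    · have : hκ.toLp _ = ((n ! : ℝ) * (p / (1 - p)) ^ n) • hq.toLp _ :=
        MemLp.toLp_const_smul ((n ! : ℝ) * (p / (1 - p)) ^ n) hq
      rw [this]
      exact Submodule.smul_mem _ _ (hρ.toLp_chaosPoly_mem_orthogonal hp0 hp1 hu hu' hq)
    · rw [hρ.monomialL2_eq hp0 hp1 hb, ← MemLp.toLp_sub]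
      exact hρ.toLp_mem_polynomialsBelow hp0 hp1 hmem
  rw [e]
  exact hκ.coeFn_toLp

theorem IsPascal.integral_monomial_mul_orthPoly_prod [IsFiniteMeasure α] (hp0 : 0 < p)
    (hp1 : p < 1) (hρ : IsPascal p α ρ) {u v : E → ℝ} (hu : Measurable u)
    (hu' : (Set.range u).Finite) (hv : Measurable v) (hv' : (Set.range v).Finite) (n : ℕ) :
    ∫ η, monomial n (fun x => ∏ i, v (x i)) η * orthPoly ρ n (fun x => ∏ i, u (x i)) η ∂ρ =
      ∫ x, (∏ i, v (x i)) * (p ^ n * (n ! : ℝ) / (1 - p) ^ (2 * n) * ∏ i, u (x i))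
        ∂(lambdaMeasure α n) := by
  obtain ⟨K, hK⟩ := exists_bound_of_finite_range hu'
  obtain ⟨L, hL⟩ := exists_bound_of_finite_range hv'
  have h1 := hρ.integral_chaosPoly_mul_pow_self hp0 hp1 hu hv hu' hv' n
  have h2 := integral_prod_lambdaMeasure α n (hu.mul hv) (K := K * L) fun x => by
    rw [Pi.mul_apply, abs_mul]
    exact mul_le_mul (hK x) (hL x) (abs_nonneg _) ((abs_nonneg _).trans (hK x))
  simp only [Pi.mul_apply] at h2
  have e1 : ∫ η, monomial n (fun x => ∏ i, v (x i)) η *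
      orthPoly ρ n (fun x => ∏ i, u (x i)) η ∂ρ = (n ! : ℝ) * (p / (1 - p)) ^ n *
        ∫ η, chaosPoly p α u n η * (∫ x, v x ∂η.1) ^ n ∂ρ := by
    rw [← integral_const_mul]
    refine integral_congr_ae ?_
    filter_upwards [hρ.orthPoly_prod_ae_eq hp0 hp1 hu hu' n] with η hη
    rw [hη, monomial_prod]
    ring
  have e2 : ∫ x, (∏ i, v (x i)) * (p ^ n * (n ! : ℝ) / (1 - p) ^ (2 * n) * ∏ i, u (x i))
      ∂(lambdaMeasure α n) = p ^ n * (n ! : ℝ) / (1 - p) ^ (2 * n) *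
        ∫ x, ∏ i, u (x i) * v (x i) ∂(lambdaMeasure α n) := by
    rw [← integral_const_mul]
    refine integral_congr_ae (Filter.Eventually.of_forall fun x => ?_)
    simp only [Finset.prod_mul_distrib]
    ring
  rw [e1, e2, h1, h2, div_pow, two_mul, pow_add]
  have : (1 - p) ≠ 0 := by linarith
  field_simp

theorem IsPascal.integral_orthPoly_mul_self [IsFiniteMeasure α] (hp0 : 0 < p)
    (hp1 : p < 1) (hρ : IsPascal p α ρ) {n : ℕ} {f g : (Fin n → E) → ℝ} (hf : IsSymmBddMeas f)
    (hg : IsSymmBddMeas g) :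
    ∫ η, orthPoly ρ n f η * orthPoly ρ n g η ∂ρ =
      p ^ n * (n ! : ℝ) / (1 - p) ^ (2 * n) * ∫ x, f x * g x ∂(lambdaMeasure α n) := by
  have hpow : ∀ u : E → ℝ, Measurable u → (Set.range u).Finite →
      IsBddMeas fun x : Fin n → E => ∏ i, u (x i) := fun u hu hu' => by
    obtain ⟨K, hK⟩ := exists_bound_of_finite_range hu'
    exact isBddMeas_prod hu hK
  have key : ∫ η, monomial n f η * orthPoly ρ n g η ∂ρ =
      ∫ x, f x * (p ^ n * (n ! : ℝ) / (1 - p) ^ (2 * n) * g x) ∂(lambdaMeasure α n) := by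
    refine (hρ.isBddClosed_inner_monomialL2 hp0 hp1 (orthPoly ρ n g) (hg.1.const_mul _)
      (lambdaMeasure α n)).of_pow_of_symm (fun u hu hu' => ?_) hf
    -- With u fixed, the identity is extended from tensor powers v to g. Symmetry of the pairing
    -- then exchanges the roles, and the outer argument extends u to f.
    have h1 := (hρ.isBddClosed_inner_monomialL2 hp0 hp1 (orthPoly ρ n fun x => ∏ i, u (x i))
      ((hpow u hu hu').const_mul (p ^ n * (n ! : ℝ) / (1 - p) ^ (2 * n)))
      (lambdaMeasure α n)).of_pow_of_symm (fun v hv hv' =>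
        hρ.integral_monomial_mul_orthPoly_prod hp0 hp1 hu hu' hv hv' n) hg
    rw [← hρ.integral_orthPoly_mul_orthPoly hp0 hp1 hg.1] at h1
    rw [← hρ.integral_orthPoly_mul_orthPoly hp0 hp1 (hpow u hu hu')]
    refine Eq.trans ?_ (h1.trans ?_)
    · exact integral_congr_ae (Filter.Eventually.of_forall fun η => mul_comm _ _)
    · exact integral_congr_ae (Filter.Eventually.of_forall fun x => by ring)
  rw [hρ.integral_orthPoly_mul_orthPoly hp0 hp1 hf.1, key, ← integral_const_mul]
  exact integral_congr_ae (Filter.Eventually.of_forall fun x => by ring)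

end

end

end Pascal

theorem mainTheorem5 {E : Type*} [MeasurableSpace E] [StandardBorelSpace E]
    (α : Measure E) [IsFiniteMeasure α] (p : ℝ) (hp0 : 0 < p) (hp1 : p < 1)
    (ρ : Measure (Pascal.CountingMeasure E)) (hρ : Pascal.IsPascal p α ρ) :
    (∀ (n : ℕ) (f : (Fin n → E) → ℝ), Pascal.IsBddMeas f →
      MemLp (Pascal.monomial n f) 2 ρ) ∧
    (∀ (n m : ℕ) (f : (Fin n → E) → ℝ) (g : (Fin m → E) → ℝ),
      Pascal.IsSymmBddMeas f → Pascal.IsSymmBddMeas g → n ≠ m →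
      ∫ η, Pascal.orthPoly ρ n f η * Pascal.orthPoly ρ m g η ∂ρ = 0) ∧
    (∀ (n : ℕ) (f g : (Fin n → E) → ℝ),
      Pascal.IsSymmBddMeas f → Pascal.IsSymmBddMeas g →
      ∫ η, Pascal.orthPoly ρ n f η * Pascal.orthPoly ρ n g η ∂ρ =
        p ^ n * (n ! : ℝ) / (1 - p) ^ (2 * n) *
          ∫ x, f x * g x ∂(Pascal.lambdaMeasure α n)) := by
  refine ⟨fun n f hf => hρ.memLp_monomial hp0 hp1 hf, fun n m f g hf hg hnm => ?_,
    fun n f g hf hg => hρ.integral_orthPoly_mul_self hp0 hp1 hf hg⟩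
  rcases hnm.lt_or_gt with h | h
  · exact Pascal.integral_orthPoly_mul_eq_zero h hf.1 g
  · simp only [mul_comm (Pascal.orthPoly ρ n f _)]
    exact Pascal.integral_orthPoly_mul_eq_zero h hg.1 f
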